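/- **Proposition.** Every $\mathbb{R}$-computable structure is $\Sigma$-definable in $HF(\mathbb{R})$, where $\mathbb{R}$ is the ordered field of real numbers. Here structures are nonempty structures $(A,P_0,P_1,\dots)$ in a finite or countable relational language with a fixed numbering of the symbols, and the notions are as follows. *$\mathbb{R}$-computable.* Let $\mathbb{R}^\infty=\bigsqcup_{n\ge 0}\mathbb{R}^n$ be the set of finite sequences of reals and $\mathbb{R}_\infty=\bigoplus_{i\in\mathbb{Z}}\mathbb{R}$. A Blum–Shub–Smale machine $M$ over $\mathbb{R}$ is a finite connected directed graph with a unique input node (no incoming edge, one outgoing edge), computation nodes (each with one outgoing edge and a rational map $\mathbb{R}_\infty\to\mathbb{R}_\infty$ that changes finitely many coordinates, each to a quotient of polynomials with real coefficients in finitely many coordinates), branch nodes (two outgoing edges, chosen by whether a real polynomial $h$ satisfies $h(x)\ge 0$ or $h(x)<0$), shift nodes (one outgoing edge; $\sigma_l(x)_i=x_{i+1}$ or $\sigma_r(x)_i=x_{i-1}$), and output nodes (no outgoing edge). The input $(x_1,\dots,x_n)$ is placed in $\mathbb{R}_\infty$ as $(\dots,0,1,\dots,1\,.\,x_1,\dots,x_n,0,\dots)$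 with $x_i$ in coordinate $i$ and $n$ ones in coordinates $-(n-1),\dots,0$; the output read from a state $x$ is $(x_1,\dots,x_l)$, where $l$ is the number of consecutive ones in coordinates $0,-1,-2,\dots$. The partial function $\varphi_M:\mathbb{R}^\infty\to\mathbb{R}^\infty$ is undefined on an input whose computation does not reach an output node or reaches a pole of a rational map. A set $S\subseteq\mathbb{R}^\infty$ is $\mathbb{R}$-computable if its characteristic function is $\varphi_M$ for some $M$. A structure with universe $A\subseteq\mathbb{R}^\infty$ is $\mathbb{R}$-computable if its atomic diagram is, where, with $\langle a\rangle=(|a|,a)$ for a finite sequence $a$ of length $|a|$, the sentence $a=b$ is coded by $(0,\langle a\rangle,\langle b\rangle)$ and $P_i(a_1,\dots,a_k)$ by $(i+1,\langle a_1\rangle,\dots,\langle a_k\rangle)$. *$HF(\mathcal{M})$.* For a structure $\mathcal{M}$ with universe $M$ (regarded as a set of atoms), let $HF_0(M)=\emptyset$ and let $HF_{n+1}(M)$ be the set of finite subsets of $M\cup HF_n(M)$. The universe of $HF(\mathcal{M})$ is $\bigcup_n HF_n(M)$; its relations are $\in$ and, for each relation symbol $\sigma$ of $\mathcal{M}$,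 the relation $\sigma^*$ that holds exactly of the tuples $(\{x_0\},\{x_1\},\dots)$ with $\mathcal{M}\models\sigma(x_0,x_1,\dots)$, and likewise for the graphs of the functions and constants of $\mathcal{M}$. The $\Delta_0$-formulas are the closure of the atomic formulas (including equalities) under $\neg,\wedge,\vee$ and bounded quantifiers $\exists x\in t$, $\forall x\in t$; the $\Sigma$-formulas are the closure of the $\Delta_0$-formulas under $\wedge,\vee$, bounded quantifiers and $\exists x$. *$\Sigma$-definable.* A structure $\mathcal{N}=(N,P_0,P_1,\dots)$ is $\Sigma$-definable in $HF(\mathcal{M})$ if there are $\Sigma$-formulas $\Psi_0,\Psi_1,\Psi_1^*,\Phi_0,\Phi_0^*,\Phi_1,\Phi_1^*,\dots$, with a common finite tuple of parameters from $HF(\mathcal{M})$, such that $\Psi_0$ defines a nonempty set $D\subseteq HF(\mathcal{M})$; $\Psi_1$ defines a binary relation on $D$ and each $\Phi_i$ a relation on $D$ of the arity $k_i$ of $P_i$; $\Psi_1^*$ defines the complement in $D^2$ of the relation defined by $\Psi_1$, and $\Phi_i^*$ the complement in $D^{k_i}$ of the relation defined by $\Phi_i$; the relation defined by $\Psi_1$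 is a congruence relation on the structure that $D$ and the relations defined by $\Phi_0,\Phi_1,\dots$ form; and $\mathcal{N}$ is isomorphic to the quotient of that structure by this congruence. -/

import Mathlib

open FirstOrder FirstOrder.Language

universe u v u' v' w

/-! ### Blum–Shub–Smale machines over `ℝ` -/

namespace BSS

/-- The state space `ℝ_∞ = ⨁_{i ∈ ℤ} ℝ`. The space `ℝ^∞` of finite sequences is `List ℝ`. -/
abbrev State : Type := ℤ →₀ ℝ

/-- A rational map `ℝ_∞ → ℝ_∞`: each of the finitely many coordinates `i ∈ coords` is replaced by
`num i / den i`, a quotient of polynomials in (finitely many of) the coordinates, and the other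
coordinates are left as they are. -/
structure RationalMap where
  coords : Finset ℤ
  num : ℤ → MvPolynomial ℤ ℝ
  den : ℤ → MvPolynomial ℤ ℝ
  den_ne_zero : ∀ i ∈ coords, den i ≠ 0

namespace RationalMap

/-- `x` is in the domain of the rational map: no denominator vanishes at `x`. -/
def DefinedAt (g : RationalMap) (x : State) : Prop :=
  ∀ i ∈ g.coords, MvPolynomial.eval (fun j => x j) (g.den i) ≠ 0

/-- The value of a rational map (meaningful where it is defined). -/
noncomputable def apply (g : RationalMap) (x : State) : State :=
  Finsupp.onFinset (x.support ∪ g.coords)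
    (fun i => if i ∈ g.coords then
        MvPolynomial.eval (fun j => x j) (g.num i) / MvPolynomial.eval (fun j => x j) (g.den i)
      else x i)
    (by
      intro i hi
      by_cases h : i ∈ g.coords
      · exact Finset.mem_union_right _ h
      · rw [if_neg h] at hi
        exact Finset.mem_union_left _ (Finsupp.mem_support_iff.mpr hi))

end RationalMap

/-- `σ_l(x)_i = x_{i+1}`. -/
noncomputable def shiftLeft (x : State) : State :=
  Finsupp.equivMapDomain (Equiv.subRight (1 : ℤ)) x

/-- `σ_r(x)_i = x_{i-1}`. -/
noncomputable def shiftRight (x : State) : State :=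
  Finsupp.equivMapDomain (Equiv.addRight (1 : ℤ)) x

theorem shiftLeft_apply (x : State) (i : ℤ) : shiftLeft x i = x (i + 1) := by
  simp [shiftLeft, Finsupp.equivMapDomain_apply]

theorem shiftRight_apply (x : State) (i : ℤ) : shiftRight x i = x (i - 1) := by
  simp [shiftRight, Finsupp.equivMapDomain_apply, sub_eq_add_neg]

/-- The standard input map `ℝ^∞ → ℝ_∞`,
`(x_1, …, x_n) ↦ (…, 0, 1, …, 1 . x_1, …, x_n, 0, …)` with `n` ones in the coordinates
`-(n-1), …, 0`, which record the length of the input, and `x_i` in the coordinate `i`. -/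
noncomputable def inputMap (z : List ℝ) : State :=
  Finsupp.onFinset (Finset.Icc (-(z.length : ℤ)) (z.length : ℤ))
    (fun i => if 1 ≤ i then z.getD (i - 1).toNat 0
      else if -(z.length : ℤ) < i then 1 else 0)
    (by
      intro i hi
      rw [Finset.mem_Icc]
      by_cases h1 : 1 ≤ i
      · rw [if_pos h1] at hi
        by_contra hcon
        apply hi
        apply List.getD_eq_default
        omega
      · rw [if_neg h1] at hi
        by_cases h2 : -(z.length : ℤ) < i
        · omega
        · simp [h2] at hi)

theorem exists_ne_one (x : State) : ∃ l : ℕ, x (-(l : ℤ)) ≠ 1 := by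
  by_contra hcon
  push Not at hcon
  have hinj : Function.Injective (fun l : ℕ => -(l : ℤ)) := fun a b h => by
    simpa using h
  refine (Set.infinite_range_of_injective hinj) (x.support.finite_toSet.subset ?_)
  rintro _ ⟨l, rfl⟩
  simp [hcon l]

open Classical in
/-- The standard output map `ℝ_∞ → ℝ^∞`: the output is `(x_1, …, x_l)`, where `l` is the number
of consecutive ones in the coordinates `0, -1, -2, …`. -/
noncomputable def outputMap (x : State) : List ℝ :=
  List.ofFn (fun j : Fin (Nat.find (exists_ne_one x)) => x ((j : ℤ) + 1))

/-- The two possible directions of a shift node. -/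
inductive Direction : Type
  | left
  | right

/-- The data attached to a node of a machine, with its outgoing edges into the set `N` of nodes. -/
inductive Node (N : Type) : Type
  | input (next : N)
  | computation (g : RationalMap) (next : N)
  /-- `next1` is taken if `h ≥ 0`, and `next0` if `h < 0`. -/
  | branch (h : MvPolynomial ℤ ℝ) (next0 next1 : N)
  | shift (d : Direction) (next : N)
  | output

/-- The targets of the outgoing edges of a node. -/
def Node.targets {N : Type} : Node N → List N
  | .input next => [next]
  | .computation _ next => [next]
  | .branch _ next0 next1 => [next0, next1]
  | .shift _ next => [next]
  | .output => []

/-- A machine over `ℝ`: a finite connected directed graph with a unique input node, which has no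
incoming edge, and with computation, branch, shift and output nodes. -/
structure Machine where
  size : ℕ
  node : Fin size → Node (Fin size)
  start : Fin size
  start_input : ∃ next, node start = .input next
  start_unique : ∀ η next, node η = .input next → η = start
  start_no_incoming : ∀ η, start ∉ (node η).targets
  connected : ∀ η η', Relation.EqvGen (fun a b => b ∈ (node a).targets) η η'

namespace Machine

/-- One step of a computation at a computation, branch or shift node. A computation that reaches a
pole of a rational function has no next step. -/
inductive Step (M : Machine) : Fin M.size × State → Fin M.size × State → Prop
  | computation {η η' : Fin M.size} {g : RationalMap} {x : State}
      (hη : M.node η = .computation g η') (hx : g.DefinedAt x) : Step M (η, x) (η', g.apply x)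
  | branch_nonneg {η η0 η1 : Fin M.size} {h : MvPolynomial ℤ ℝ} {x : State}
      (hη : M.node η = .branch h η0 η1) (hx : 0 ≤ MvPolynomial.eval (fun j => x j) h) :
      Step M (η, x) (η1, x)
  | branch_neg {η η0 η1 : Fin M.size} {h : MvPolynomial ℤ ℝ} {x : State}
      (hη : M.node η = .branch h η0 η1) (hx : MvPolynomial.eval (fun j => x j) h < 0) :
      Step M (η, x) (η0, x)
  | shift_left {η η' : Fin M.size} {x : State}
      (hη : M.node η = .shift .left η') : Step M (η, x) (η', shiftLeft x)
  | shift_right {η η' : Fin M.size} {x : State}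
      (hη : M.node η = .shift .right η') : Step M (η, x) (η', shiftRight x)

/-- `φ_M(z)` is defined and equal to `w`: there is a computation that starts at the input node
with `z`, ends at an output node, and has the result `w`. -/
def Computes (M : Machine) (z w : List ℝ) : Prop :=
  ∃ (next η : Fin M.size) (x : State), M.node M.start = .input next ∧
    Relation.ReflTransGen M.Step (next, inputMap z) (η, x) ∧
    M.node η = .output ∧ outputMap x = w

theorem step_unique {M : Machine} {a b c : Fin M.size × State} (h : M.Step a b)
    (h' : M.Step a c) : b = c := by
  cases h <;> cases h' <;> simp_all <;> linarith

theorem no_step {M : Machine} {η : Fin M.size} {x : State} {b : Fin M.size × State}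
    (h : M.node η = .output) (h' : M.Step (η, x) b) : False := by
  cases h' <;> simp_all

/-- `φ_M` is a (partial) function. -/
theorem computes_unique {M : Machine} {z w w' : List ℝ} (h : M.Computes z w)
    (h' : M.Computes z w') : w = w' := by
  obtain ⟨n, η, x, h1, h2, h3, rfl⟩ := h
  obtain ⟨n', η', x', h1', h2', h3', rfl⟩ := h'
  have hn : n = n' := by simp_all
  subst hn
  have key : Relation.ReflTransGen M.Step (η, x) (η', x') ∨
      Relation.ReflTransGen M.Step (η', x') (η, x) :=
    Relation.ReflTransGen.total_of_right_unique (fun _ _ _ => step_unique) h2 h2'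
  rcases key with k | k
  · rcases Relation.ReflTransGen.cases_head k with e | ⟨d, hd, _⟩
    · simp_all
    · exact (no_step h3 hd).elim
  · rcases Relation.ReflTransGen.cases_head k with e | ⟨d, hd, _⟩
    · simp_all
    · exact (no_step h3' hd).elim

end Machine

open Classical in
/-- A set of finite sequences is `ℝ`-computable if its characteristic function is `φ_M` for some
machine `M`. -/
def IsRComputableSet (S : Set (List ℝ)) : Prop :=
  ∃ M : Machine, ∀ z : List ℝ, M.Computes z (if z ∈ S then [1] else [0])

end BSS

/-! ### `ℝ`-computable structures -/

namespace RStructure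

/-- A self-delimiting code of a finite sequence: its length followed by its entries. -/
def block (a : List ℝ) : List ℝ := (a.length : ℝ) :: a

/-- The code of the atomic sentence `a = b`. -/
def eqCode (a b : List ℝ) : List ℝ := 0 :: (block a ++ block b)

/-- The code of the atomic sentence `R(a_1, …, a_k)`. -/
noncomputable def relCode {L : FirstOrder.Language.{u, v}} [Encodable (Σ n, L.Relations n)]
    {n : ℕ} (R : L.Relations n) (a : Fin n → List ℝ) : List ℝ :=
  ((Encodable.encode (⟨n, R⟩ : Σ n, L.Relations n) : ℝ) + 1) :: (List.ofFn a).flatMap block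

/-- The (coded) atomic diagram of a structure whose universe is a set of finite sequences of
reals: the codes of the true atomic sentences, including the equalities. As `a = a` is in it
exactly if `a` is in the universe, a decision procedure for it also decides the universe and the
negated atomic sentences. -/
def atomicDiagram (L : FirstOrder.Language.{u, v}) [Encodable (Σ n, L.Relations n)]
    (A : Set (List ℝ)) [L.Structure A] : Set (List ℝ) :=
  {z | (∃ a b : A, a = b ∧ z = eqCode a b) ∨
    ∃ (n : ℕ) (R : L.Relations n) (a : Fin n → A),
      Structure.RelMap R a ∧ z = relCode R (fun i => (a i : List ℝ))}

/-- A structure in a relational language is `ℝ`-computable if its atomic diagram is. -/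
def IsRComputable (L : FirstOrder.Language.{u, v}) [L.IsRelational] [Encodable (Σ n, L.Relations n)]
    (A : Set (List ℝ)) [L.Structure A] : Prop :=
  BSS.IsRComputableSet (atomicDiagram L A)

end RStructure

/-! ### The hereditarily finite sets over a structure -/

/-- `HF_0(M) = ∅` and `HF_{n+1}(M)` is the set of finite subsets of `M ∪ HF_n(M)`, where the
elements of `M` are atoms. -/
def HFLevel (M : Type u) : ℕ → Type u
  | 0 => PEmpty
  | n + 1 => Finset (M ⊕ HFLevel M n)

/-- The inclusion of `HF_n(M)` in `HF_{n+1}(M)`. -/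
def HFLevel.incl (M : Type u) : ∀ n : ℕ, HFLevel M n ↪ HFLevel M (n + 1)
  | 0 => ⟨fun x => PEmpty.elim x, fun x => PEmpty.elim x⟩
  | n + 1 => ⟨Finset.map (Function.Embedding.sumMap (Function.Embedding.refl M) (incl M n)),
      Finset.map_injective _⟩

/-- The union of the chain `HF_n(M)`: the universe of `HF(M)`. -/
def HF (M : Type u) : Type u :=
  Quot (fun a b : Σ n, HFLevel M n => b = ⟨a.1 + 1, HFLevel.incl M a.1 a.2⟩)

namespace HF

variable {M : Type u}

/-- An element of `HF_n(M)` as an element of the union. -/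
def mk (n : ℕ) (x : HFLevel M n) : HF M := Quot.mk _ ⟨n, x⟩

/-- Membership between hereditarily finite sets. -/
instance : Membership (HF M) (HF M) where
  mem b a := ∃ (n : ℕ) (x : HFLevel M n) (y : HFLevel M (n + 1)),
    a = mk n x ∧ b = mk (n + 1) y ∧ (Sum.inr x : M ⊕ HFLevel M n) ∈ (show Finset _ from y)

/-- The set `{x}`, for an atom `x`. -/
def atomSingleton (x : M) : HF M :=
  mk 1 (show Finset (M ⊕ HFLevel M 0) from {Sum.inl x})

theorem mk_incl (n : ℕ) (x : HFLevel M n) : mk (n + 1) (HFLevel.incl M n x) = mk n x :=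
  (Quot.sound (r := fun a b : Σ n, HFLevel M n => b = ⟨a.1 + 1, HFLevel.incl M a.1 a.2⟩)
    (a := ⟨n, x⟩) rfl).symm

/-- The inclusion of `HF_n(M)` in `HF_m(M)` for `n ≤ m`. -/
def inclTo {n m : ℕ} (h : n ≤ m) (x : HFLevel M n) : HFLevel M m :=
  Nat.leRecOn h (fun {k} y => HFLevel.incl M k y) x

theorem inclTo_injective {n m : ℕ} (h : n ≤ m) :
    Function.Injective (inclTo h : HFLevel M n → HFLevel M m) :=
  Nat.leRecOn_injective h (@fun k y => HFLevel.incl M k y) (@fun k => (HFLevel.incl M k).injective)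

theorem inclTo_inclTo {n m k : ℕ} (h : n ≤ m) (h' : m ≤ k) (x : HFLevel M n) :
    inclTo h' (inclTo h x) = inclTo (h.trans h') x :=
  (Nat.leRecOn_trans h h' x).symm

theorem mk_inclTo {n m : ℕ} (h : n ≤ m) (x : HFLevel M n) : mk m (inclTo h x) = mk n x := by
  induction m, h using Nat.le_induction with
  | base => rw [inclTo, Nat.leRecOn_self]
  | succ m h ih =>
    rw [inclTo, Nat.leRecOn_succ h, mk_incl]
    exact ih

theorem mk_eq_mk {n m : ℕ} {x : HFLevel M n} {y : HFLevel M m} :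
    mk n x = mk m y ↔ ∃ (k : ℕ) (h : n ≤ k) (h' : m ≤ k), inclTo h x = inclTo h' y := by
  constructor
  · intro e
    have key : ∀ a b : Σ n, HFLevel M n,
        Relation.EqvGen (fun a b => b = ⟨a.1 + 1, HFLevel.incl M a.1 a.2⟩) a b →
        ∃ (k : ℕ) (h : a.1 ≤ k) (h' : b.1 ≤ k), inclTo h a.2 = inclTo h' b.2 := by
      intro a b hab
      induction hab with
      | rel a b h =>
        subst h
        refine ⟨a.1 + 1, Nat.le_succ _, le_rfl, ?_⟩
        simp only [inclTo, Nat.leRecOn_self]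
        rw [Nat.leRecOn_succ le_rfl, Nat.leRecOn_self]
      | refl a => exact ⟨a.1, le_rfl, le_rfl, rfl⟩
      | symm a b _ ih =>
        obtain ⟨k, h, h', e⟩ := ih
        exact ⟨k, h', h, e.symm⟩
      | trans a b c _ _ ih1 ih2 =>
        obtain ⟨k, h1, h2, e⟩ := ih1
        obtain ⟨l, h3, h4, e'⟩ := ih2
        refine ⟨max k l, h1.trans (le_max_left _ _), h4.trans (le_max_right _ _), ?_⟩
        rw [← inclTo_inclTo h1 (le_max_left _ _), e, inclTo_inclTo,
          ← inclTo_inclTo h4 (le_max_right _ _), ← e', inclTo_inclTo]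
    exact key _ _ (Quot.eqvGen_exact e)
  · rintro ⟨k, h, h', e⟩
    rw [← mk_inclTo h x, e, mk_inclTo]

theorem mk_injective (n : ℕ) : Function.Injective (mk n : HFLevel M n → HF M) := by
  intro x y e
  obtain ⟨k, h, h', e⟩ := mk_eq_mk.mp e
  exact inclTo_injective h e

theorem inclTo_succ {n m : ℕ} (h : n ≤ m) (y : HFLevel M (n + 1)) :
    inclTo (Nat.succ_le_succ h) y =
      Finset.map (Function.Embedding.sumMap (Function.Embedding.refl M)
        ⟨inclTo h, inclTo_injective h⟩) (show Finset (M ⊕ HFLevel M n) from y) := by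
  induction m, h using Nat.le_induction with
  | base =>
    have e : Function.Embedding.sumMap (Function.Embedding.refl M)
        ⟨inclTo (le_refl n), inclTo_injective (le_refl n)⟩ =
        Function.Embedding.refl (M ⊕ HFLevel M n) := by
      ext a
      rcases a with a | a
      · rfl
      · simp [inclTo, Nat.leRecOn_self]
    rw [e, Finset.map_refl, inclTo, Nat.leRecOn_self]
  | succ m h ih =>
    have e : inclTo (Nat.succ_le_succ (Nat.le_succ_of_le h)) y =
        HFLevel.incl M (m + 1) (inclTo (Nat.succ_le_succ h) y) := by
      rw [inclTo, Nat.leRecOn_succ (Nat.succ_le_succ h)]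
      rfl
    rw [e, ih]
    refine (Finset.map_map _ _ _).trans ?_
    congr 1
    ext a
    rcases a with a | a
    · rfl
    · simp [inclTo, Nat.leRecOn_succ h]

/-- The elements in `HF(M)` of a set `y ∈ HF_{n+1}(M)`. -/
theorem mem_mk {a : HF M} {n : ℕ} {y : HFLevel M (n + 1)} :
    a ∈ mk (n + 1) y ↔ ∃ x : HFLevel M n, a = mk n x ∧
      (Sum.inr x : M ⊕ HFLevel M n) ∈ (show Finset _ from y) := by
  constructor
  · rintro ⟨m, x, z, rfl, e, hx⟩
    obtain ⟨k, h, h', e⟩ := mk_eq_mk.mp e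
    obtain ⟨k, rfl⟩ : ∃ j, k = j + 1 := ⟨k - 1, by omega⟩
    have h1 : n ≤ k := by omega
    have h2 : m ≤ k := by omega
    rw [inclTo_succ h1, inclTo_succ h2] at e
    have e' := Finset.ext_iff.mp e (Sum.inr (inclTo h2 x))
    have hmem := e'.mpr (Finset.mem_map.mpr ⟨Sum.inr x, hx, rfl⟩)
    obtain ⟨b, hb, hbe⟩ := Finset.mem_map.mp hmem
    rcases b with b | b
    · simp at hbe
    · have hbe' : inclTo h1 b = inclTo h2 x := by simpa using hbe
      exact ⟨b, mk_eq_mk.mpr ⟨k, h2, h1, hbe'.symm⟩, hb⟩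
  · rintro ⟨x, rfl, hx⟩
    exact ⟨n, x, y, rfl, rfl, hx⟩

theorem atomSingleton_injective : Function.Injective (atomSingleton : M → HF M) := by
  intro x y e
  have := mk_injective 1 e
  simpa using (show ({Sum.inl x} : Finset (M ⊕ HFLevel M 0)) = {Sum.inl y} from this)

end HF

/-- The relation symbols of the language of `HF(M)` for an `L`-structure `M`: membership, a symbol
`R*` for each relation symbol `R` of `L`, and a symbol for the graph of each function or constant
symbol of `L`. -/
inductive HFRel (L : FirstOrder.Language.{u, v}) : ℕ → Type (max u v)
  | mem : HFRel L 2
  | rel {n : ℕ} (R : L.Relations n) : HFRel L n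
  | graph {n : ℕ} (f : L.Functions n) : HFRel L (n + 1)

/-- The language of `HF(M)` for an `L`-structure `M`. -/
def hfLang (L : FirstOrder.Language.{u, v}) : FirstOrder.Language.{0, max u v} := ⟨fun _ => Empty, HFRel L⟩

instance (L : FirstOrder.Language.{u, v}) : (hfLang L).IsRelational :=
  fun _ => inferInstanceAs (IsEmpty Empty)

/-- The membership symbol of the language of `HF(M)`. -/
abbrev memSymb (L : FirstOrder.Language.{u, v}) : (hfLang L).Relations 2 := HFRel.mem

/-- The structure `HF(M)`: membership is the true one, `R*({x_1}, …, {x_n})` holds exactly if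
`R(x_1, …, x_n)` does, and the same for the graphs of the functions of `M`. -/
instance hfStructure (L : FirstOrder.Language.{u, v}) (M : Type w) [L.Structure M] :
    (hfLang L).Structure (HF M) where
  funMap := fun f => Empty.elim f
  RelMap := fun {n} r => match n, r with
    | _, HFRel.mem => fun s => s 0 ∈ s 1
    | _, HFRel.rel R => fun s =>
        ∃ x : Fin _ → M, (∀ i, s i = HF.atomSingleton (x i)) ∧ Structure.RelMap R x
    | _, HFRel.graph f => fun s =>
        ∃ x : Fin _ → M, (∀ i : Fin _, s i.castSucc = HF.atomSingleton (x i)) ∧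
          s (Fin.last _) = HF.atomSingleton (Structure.funMap f x)

/-! ### `Σ`-formulas -/

/-- For a term `t` in the variables of a formula with `n` bound variables, the formula
`x_n ∈ t`, where `x_n` is the next bound variable. -/
def memBound {L : FirstOrder.Language.{u, v}} {α : Type w} {n : ℕ} (t : (hfLang L).Term (α ⊕ Fin n)) :
    (hfLang L).BoundedFormula α (n + 1) :=
  (memSymb L).boundedFormula₂
    (Term.var (Sum.inr (Fin.last n))) (t.relabel (Sum.map id Fin.castSucc))

/-- `∃ x ∈ t, φ` -/
def bex {L : FirstOrder.Language.{u, v}} {α : Type w} {n : ℕ} (t : (hfLang L).Term (α ⊕ Fin n))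
    (φ : (hfLang L).BoundedFormula α (n + 1)) : (hfLang L).BoundedFormula α n :=
  ∃' (memBound t ⊓ φ)

/-- `∀ x ∈ t, φ` -/
def ball {L : FirstOrder.Language.{u, v}} {α : Type w} {n : ℕ} (t : (hfLang L).Term (α ⊕ Fin n))
    (φ : (hfLang L).BoundedFormula α (n + 1)) : (hfLang L).BoundedFormula α n :=
  ∀' (memBound t ⟹ φ)

/-- The `Δ₀`-formulas: the closure of the atomic formulas under `¬`, `∧`, `∨` and bounded
quantification. -/
inductive IsDelta0 {L : FirstOrder.Language.{u, v}} {α : Type w} :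
    ∀ {n : ℕ}, (hfLang L).BoundedFormula α n → Prop
  | atomic {n : ℕ} {φ : (hfLang L).BoundedFormula α n} (h : φ.IsAtomic) : IsDelta0 φ
  | not {n : ℕ} {φ : (hfLang L).BoundedFormula α n} (h : IsDelta0 φ) : IsDelta0 (∼φ)
  | and {n : ℕ} {φ ψ : (hfLang L).BoundedFormula α n} (h : IsDelta0 φ) (h' : IsDelta0 ψ) :
      IsDelta0 (φ ⊓ ψ)
  | or {n : ℕ} {φ ψ : (hfLang L).BoundedFormula α n} (h : IsDelta0 φ) (h' : IsDelta0 ψ) :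
      IsDelta0 (φ ⊔ ψ)
  | bex {n : ℕ} (t : (hfLang L).Term (α ⊕ Fin n)) {φ : (hfLang L).BoundedFormula α (n + 1)}
      (h : IsDelta0 φ) : IsDelta0 (bex t φ)
  | ball {n : ℕ} (t : (hfLang L).Term (α ⊕ Fin n)) {φ : (hfLang L).BoundedFormula α (n + 1)}
      (h : IsDelta0 φ) : IsDelta0 (ball t φ)

/-- The `Σ`-formulas: the closure of the `Δ₀`-formulas under `∧`, `∨`, bounded quantification and
unbounded existential quantification. -/
inductive IsSigma {L : FirstOrder.Language.{u, v}} {α : Type w} :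
    ∀ {n : ℕ}, (hfLang L).BoundedFormula α n → Prop
  | delta0 {n : ℕ} {φ : (hfLang L).BoundedFormula α n} (h : IsDelta0 φ) : IsSigma φ
  | and {n : ℕ} {φ ψ : (hfLang L).BoundedFormula α n} (h : IsSigma φ) (h' : IsSigma ψ) :
      IsSigma (φ ⊓ ψ)
  | or {n : ℕ} {φ ψ : (hfLang L).BoundedFormula α n} (h : IsSigma φ) (h' : IsSigma ψ) :
      IsSigma (φ ⊔ ψ)
  | bex {n : ℕ} (t : (hfLang L).Term (α ⊕ Fin n)) {φ : (hfLang L).BoundedFormula α (n + 1)}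
      (h : IsSigma φ) : IsSigma (bex t φ)
  | ball {n : ℕ} (t : (hfLang L).Term (α ⊕ Fin n)) {φ : (hfLang L).BoundedFormula α (n + 1)}
      (h : IsSigma φ) : IsSigma (ball t φ)
  | ex {n : ℕ} {φ : (hfLang L).BoundedFormula α (n + 1)} (h : IsSigma φ) : IsSigma (∃' φ)

/-- A `Σ`-formula with the free variables `x_1, …, x_k` and the parameter variables
`c_1, …, c_p`. -/
def SigmaFormula (L : FirstOrder.Language.{u, v}) (p k : ℕ) : Type (max u v) :=
  {φ : (hfLang L).Formula (Fin k ⊕ Fin p) // IsSigma φ}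

/-- The `k`-ary relation on `HF(M)` that a `Σ`-formula defines with the parameters `c`. -/
def SigmaFormula.definedSet {L : FirstOrder.Language.{u, v}} {M : Type w} [L.Structure M] {p k : ℕ}
    (φ : SigmaFormula L p k) (c : Fin p → HF M) : Set (Fin k → HF M) :=
  {s | φ.1.Realize (Sum.elim s c)}

/-- A structure `N` in a relational language `L'` is `Σ`-definable in `HF(M)`: with finitely many
parameters `c` there are `Σ`-formulas `Ψ₀`, `Ψ₁`, `Ψ₁*` and, for every relation symbol `R`,
`Φ_R`, `Φ_R*`, such that `Ψ₀` defines a nonempty set `D`; `Ψ₁` and `Φ_R` define relations on `D`,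
and `Ψ₁*` and `Φ_R*` define their complements relative to powers of `D`; `Ψ₁` defines a congruence
relation `s` of the structure `(D, (Φ_R)_R)`; and `N` is isomorphic to the quotient structure. -/
def IsSigmaDefinable (L' : FirstOrder.Language.{u', v'}) [L'.IsRelational] (N : Type w) [L'.Structure N]
    (L : FirstOrder.Language.{u, v}) (M : Type w) [L.Structure M] : Prop :=
  ∃ (p : ℕ) (c : Fin p → HF M) (Ψ₀ : SigmaFormula L p 1) (Ψ₁ Ψ₁' : SigmaFormula L p 2)
    (Φ Φ' : ∀ n : ℕ, L'.Relations n → SigmaFormula L p n) (D : Set (HF M)),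
    (∀ a : HF M, a ∈ D ↔ ![a] ∈ Ψ₀.definedSet c) ∧
    D.Nonempty ∧
    Ψ₁.definedSet c ⊆ {x | ∀ i, x i ∈ D} ∧
    Ψ₁'.definedSet c = {x | ∀ i, x i ∈ D} \ Ψ₁.definedSet c ∧
    (∀ (n : ℕ) (R : L'.Relations n), (Φ n R).definedSet c ⊆ {x | ∀ i, x i ∈ D}) ∧
    (∀ (n : ℕ) (R : L'.Relations n),
      (Φ' n R).definedSet c = {x | ∀ i, x i ∈ D} \ (Φ n R).definedSet c) ∧
    ∃ (s : Setoid D) (P : L'.Prestructure s),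
      (∀ a b : D, s a b ↔ ![(a : HF M), (b : HF M)] ∈ Ψ₁.definedSet c) ∧
      (∀ (n : ℕ) (R : L'.Relations n) (x : Fin n → D),
        P.toStructure.RelMap R x ↔ (fun i => (x i : HF M)) ∈ (Φ n R).definedSet c) ∧
      Nonempty (N ≃[L'] Quotient s)

/-- The language of ordered rings, `{+, ·, -, 0, 1, ≤}`. -/
abbrev orderedRingLang : FirstOrder.Language.{0, 0} := Language.ring.sum Language.order

/-- The ordered field of real numbers as a first-order structure. -/
noncomputable instance realOrderedField : orderedRingLang.Structure ℝ :=
  letI : FirstOrder.Language.ring.Structure ℝ := (FirstOrder.Ring.compatibleRingOfRing ℝ).toStructure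
  letI : FirstOrder.Language.order.Structure ℝ := orderStructure ℝ
  inferInstance

/-! A halting computation is a finite object, and finite objects live in `HF(ℝ)`. So "`M` has the
output `b` on this input" says that some finite set of configurations witnesses it, which is a
Σ-condition with the coefficients of `M` as parameters. Σ-formulas are not closed under negation,
but a machine for a characteristic function halts on every input: the outputs `1` and `0` give
Σ-definitions of the atomic diagram and of its complement (`decides_one_iff`, `decides_zero_iff`).
This supplies the starred formulas.

The witness is an unordered set `T`, not a sequence: it contains an initial configuration, and each
member is halted with output `b` or has a successor in `T`. A computation that really halts can be
followed inside `T`, because successors are determined up to the choice of code, and it ends at a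
halted member, so its output is `b` (`output_of_closed`). Superfluous members do no harm. For a
diverging computation a cycle could serve as `T`, so totality matters. The same device, in `Push`,
copies sequences to the tape and counts their lengths.

Lists are built from cells `{{x}, t}`, read by total functions `head` and `tail` whose defaults `0`
and `∅` make every list continue with zeros, as a finitely supported tape does. A tape is a pair of
lists, and a configuration is a tuple of lists with a number. A sequence has many codes; `D`
consists of all codes of elements of `A`, and `Ψ₁` is the kernel of decoding, so `A` is the
quotient. -/

namespace SigmaReal

/-! ### Σ-definable predicates on `HF(ℝ)` -/

/-- The tuples of elements of `HF(ℝ)` of length `n`, as values of `n` variables. -/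
abbrev Env (n : ℕ) : Type := Fin n → HF ℝ

namespace Env

/-- The value of the last variable. -/
def hd {n : ℕ} (e : Env (n + 1)) : HF ℝ := e (Fin.last n)

/-- The values of all variables but the last. -/
def tl {n : ℕ} (e : Env (n + 1)) : Env n := fun i => e i.castSucc

theorem tl_eq {n : ℕ} (e : Env (n + 1)) : e.tl = fun i => e i.castSucc := rfl

end Env

open Env

variable {p : ℕ} {c : Fin p → HF ℝ} {n : ℕ}

/-- `P` is definable by a Σ-formula with the parameters `c`, whatever variables of a larger context
hold its arguments and the parameters. -/
def Sig (c : Fin p → HF ℝ) (P : Env n → Prop) : Prop :=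
  ∀ (α : Type) (m : ℕ) (κ : Fin p → α ⊕ Fin m) (ρ : Fin n → α ⊕ Fin m),
    ∃ φ : (hfLang orderedRingLang).BoundedFormula α m, IsSigma φ ∧
      ∀ (v : α → HF ℝ) (e : Fin m → HF ℝ), (∀ j, Sum.elim v e (κ j) = c j) →
        (φ.Realize v e ↔ P (fun i => Sum.elim v e (ρ i)))

theorem Sig.congr {P Q : Env n → Prop} (h : Sig c P) (hPQ : ∀ e, P e ↔ Q e) : Sig c Q := by
  rwa [show Q = P from funext fun e => propext (hPQ e).symm]

/-- Renaming costs nothing because `Sig` already allows every placement `ρ` of the arguments. -/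
theorem Sig.reindex {m : ℕ} {P : Env n → Prop} (h : Sig c P) (σ : Fin n → Fin m) :
    Sig c (fun e : Env m => P (fun i => e (σ i))) :=
  fun α m' κ ρ => h α m' κ (fun i => ρ (σ i))

theorem Sig.and {P Q : Env n → Prop} (h : Sig c P) (h' : Sig c Q) :
    Sig c (fun e => P e ∧ Q e) := by
  intro α m κ ρ
  obtain ⟨φ, hφ, h1⟩ := h α m κ ρ
  obtain ⟨ψ, hψ, h2⟩ := h' α m κ ρ
  refine ⟨φ ⊓ ψ, hφ.and hψ, fun v e hc => ?_⟩
  rw [BoundedFormula.realize_inf, h1 v e hc, h2 v e hc]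

theorem Sig.or {P Q : Env n → Prop} (h : Sig c P) (h' : Sig c Q) :
    Sig c (fun e => P e ∨ Q e) := by
  intro α m κ ρ
  obtain ⟨φ, hφ, h1⟩ := h α m κ ρ
  obtain ⟨ψ, hψ, h2⟩ := h' α m κ ρ
  refine ⟨φ ⊔ ψ, hφ.or hψ, fun v e hc => ?_⟩
  rw [BoundedFormula.realize_sup, h1 v e hc, h2 v e hc]

theorem elim_snoc_map {α : Type} {m : ℕ} (v : α → HF ℝ) (e : Fin m → HF ℝ) (a : HF ℝ)
    (i : α ⊕ Fin m) :
    Sum.elim v (Fin.snoc e a : Fin (m + 1) → HF ℝ) (Sum.map id Fin.castSucc i) =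
      Sum.elim v e i := by
  rcases i with i | i <;> simp

/-- The body of a quantifier over a predicate with one more variable. -/
theorem Sig.body {P : Env n → HF ℝ → Prop} (h : Sig c (fun e : Env (n + 1) => P e.tl e.hd))
    {α : Type} {m : ℕ} (κ : Fin p → α ⊕ Fin m) (ρ : Fin n → α ⊕ Fin m) :
    ∃ φ : (hfLang orderedRingLang).BoundedFormula α (m + 1), IsSigma φ ∧
      ∀ (v : α → HF ℝ) (e : Fin m → HF ℝ) (a : HF ℝ), (∀ j, Sum.elim v e (κ j) = c j) →
        (φ.Realize v (Fin.snoc e a) ↔ P (fun i => Sum.elim v e (ρ i)) a) := by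
  obtain ⟨φ, hφ, h1⟩ := h α (m + 1) (fun j => Sum.map id Fin.castSucc (κ j))
    (Fin.snoc (fun i => Sum.map id Fin.castSucc (ρ i)) (Sum.inr (Fin.last m)))
  refine ⟨φ, hφ, fun v e a hc => ?_⟩
  rw [h1 v _ (fun j => (elim_snoc_map v e a _).trans (hc j))]
  simp only [hd, tl_eq, Fin.snoc_last, Fin.snoc_castSucc, Sum.elim_inr, elim_snoc_map]

theorem Sig.ex {P : Env n → HF ℝ → Prop} (h : Sig c (fun e : Env (n + 1) => P e.tl e.hd)) :
    Sig c (fun e => ∃ a, P e a) := by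
  intro α m κ ρ
  obtain ⟨φ, hφ, h1⟩ := h.body κ ρ
  refine ⟨∃' φ, hφ.ex, fun v e hc => ?_⟩
  rw [BoundedFormula.realize_ex]
  exact exists_congr fun a => h1 v e a hc

theorem realize_memBound {α : Type} {m : ℕ} (i : α ⊕ Fin m) (v : α → HF ℝ) (e : Fin m → HF ℝ)
    (a : HF ℝ) :
    (memBound (L := orderedRingLang) (Term.var i)).Realize v (Fin.snoc e a) ↔
      a ∈ Sum.elim v e i := by
  rw [memBound, BoundedFormula.realize_rel₂]
  change Term.realize _ _ ∈ Term.realize _ _ ↔ _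
  simp only [Term.relabel, Term.realize_var, elim_snoc_map]
  simp

theorem Sig.bexVar {P : Env n → HF ℝ → Prop} (i : Fin n)
    (h : Sig c (fun e : Env (n + 1) => P e.tl e.hd)) :
    Sig c (fun e => ∃ a ∈ e i, P e a) := by
  intro α m κ ρ
  obtain ⟨φ, hφ, h1⟩ := h.body κ ρ
  refine ⟨bex (Term.var (ρ i)) φ, hφ.bex _, fun v e hc => ?_⟩
  rw [bex, BoundedFormula.realize_ex]
  refine exists_congr fun a => ?_
  rw [BoundedFormula.realize_inf, realize_memBound, h1 v e a hc]

theorem Sig.ballVar {P : Env n → HF ℝ → Prop} (i : Fin n)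
    (h : Sig c (fun e : Env (n + 1) => P e.tl e.hd)) :
    Sig c (fun e => ∀ a ∈ e i, P e a) := by
  intro α m κ ρ
  obtain ⟨φ, hφ, h1⟩ := h.body κ ρ
  refine ⟨ball (Term.var (ρ i)) φ, hφ.ball _, fun v e hc => ?_⟩
  rw [ball, BoundedFormula.realize_all]
  refine forall_congr' fun a => ?_
  rw [BoundedFormula.realize_imp, realize_memBound, h1 v e a hc]

/-! Atomic formulas and their negations. -/

theorem Sig.rel {k : ℕ} (r : HFRel orderedRingLang k) (i : Fin k → Fin n) :
    Sig c (fun e => Structure.RelMap (L := hfLang orderedRingLang) (M := HF ℝ) r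
      (fun j => e (i j))) := by
  intro α m κ ρ
  refine ⟨BoundedFormula.rel (L := hfLang orderedRingLang) r (fun j => Term.var (ρ (i j))),
    .delta0 (.atomic (.rel _ _)), fun v e _ => ?_⟩
  rfl

theorem Sig.not_rel {k : ℕ} (r : HFRel orderedRingLang k) (i : Fin k → Fin n) :
    Sig c (fun e => ¬ Structure.RelMap (L := hfLang orderedRingLang) (M := HF ℝ) r
      (fun j => e (i j))) := by
  intro α m κ ρ
  refine ⟨∼(BoundedFormula.rel (L := hfLang orderedRingLang) r (fun j => Term.var (ρ (i j)))),
    .delta0 (.not (.atomic (.rel _ _))), fun v e _ => ?_⟩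
  rw [BoundedFormula.realize_not]
  rfl

theorem Sig.eqVar (i j : Fin n) : Sig c (fun e => e i = e j) := by
  intro α m κ ρ
  refine ⟨(Term.var (ρ i)).bdEqual (Term.var (ρ j)), .delta0 (.atomic (.equal _ _)),
    fun v e _ => ?_⟩
  rw [BoundedFormula.realize_bdEqual]
  rfl

theorem Sig.neVar (i j : Fin n) : Sig c (fun e => e i ≠ e j) := by
  intro α m κ ρ
  refine ⟨∼((Term.var (ρ i)).bdEqual (Term.var (ρ j))), .delta0 (.not (.atomic (.equal _ _))),
    fun v e _ => ?_⟩
  rw [BoundedFormula.realize_not, BoundedFormula.realize_bdEqual]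
  rfl

theorem Sig.eqParam (i : Fin n) (j : Fin p) : Sig c (fun e => e i = c j) := by
  intro α m κ ρ
  refine ⟨(Term.var (ρ i)).bdEqual (Term.var (κ j)), .delta0 (.atomic (.equal _ _)),
    fun v e hc => ?_⟩
  rw [BoundedFormula.realize_bdEqual, ← hc j]
  rfl

/-- The quantifier supplies a variable to write `a = a` with, since `n` and `p` may both be `0`. -/
theorem Sig.true : Sig c (fun _ : Env n => True) :=
  (Sig.ex (P := fun _ a => a = a) (Sig.eqVar (Fin.last n) (Fin.last n))).congr fun _ =>
    ⟨fun _ => trivial, fun _ => ⟨HF.atomSingleton 0, rfl⟩⟩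

theorem Sig.false : Sig c (fun _ : Env n => False) :=
  (Sig.ex (P := fun _ a => a ≠ a) (Sig.neVar (Fin.last n) (Fin.last n))).congr fun _ =>
    ⟨fun ⟨_, h⟩ => h rfl, False.elim⟩

theorem Sig.of_const {Q : Prop} : Sig c (fun _ : Env n => Q) := by
  by_cases h : Q
  · exact Sig.true.congr fun _ => by simp [h]
  · exact Sig.false.congr fun _ => by simp [h]

theorem Sig.exists_finset {ι : Type*} (s : Finset ι) {P : ι → Env n → Prop}
    (h : ∀ i ∈ s, Sig c (P i)) : Sig c (fun e => ∃ i ∈ s, P i e) := by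
  classical
  induction s using Finset.induction_on with
  | empty => exact Sig.false.congr fun _ => by simp
  | insert a s _ ih =>
    refine ((h a (by simp)).or (ih fun i hi => h i (by simp [hi]))).congr fun e => ?_
    simp

theorem Sig.forall_finset {ι : Type*} (s : Finset ι) {P : ι → Env n → Prop}
    (h : ∀ i ∈ s, Sig c (P i)) : Sig c (fun e => ∀ i ∈ s, P i e) := by
  classical
  induction s using Finset.induction_on with
  | empty => exact Sig.true.congr fun _ => by simp
  | insert a s _ ih =>
    refine ((h a (by simp)).and (ih fun i hi => h i (by simp [hi]))).congr fun e => ?_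
    simp

theorem Sig.exists_fin {k : ℕ} {P : Fin k → Env n → Prop}
    (h : ∀ i, Sig c (P i)) : Sig c (fun e => ∃ i, P i e) :=
  (Sig.exists_finset Finset.univ fun i _ => h i).congr fun e => by simp

theorem Sig.forall_fin {k : ℕ} {P : Fin k → Env n → Prop}
    (h : ∀ i, Sig c (P i)) : Sig c (fun e => ∀ i, P i e) :=
  (Sig.forall_finset Finset.univ fun i _ => h i).congr fun e => by simp

/-! ### Functions with a Σ-definable graph -/

/-- The graph of the function `f` is Σ-definable with the parameters `c`. -/
def SFun (c : Fin p → HF ℝ) (f : Env n → HF ℝ) : Prop :=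
  Sig c (fun e : Env (n + 1) => e.hd = f e.tl)

/-- The language has no function symbols, so a value is inserted as `∃ a, a = f e ∧ P e a`. -/
theorem Sig.comp {P : Env n → HF ℝ → Prop} {f : Env n → HF ℝ}
    (h : Sig c (fun e : Env (n + 1) => P e.tl e.hd)) (hf : SFun c f) :
    Sig c (fun e => P e (f e)) :=
  (Sig.ex (P := fun e a => a = f e ∧ P e a) (hf.and h)).congr fun e => by simp

theorem Sig.wk {P : Env n → Prop} (h : Sig c P) : Sig c (fun e : Env (n + 1) => P e.tl) :=
  h.reindex Fin.castSucc

theorem SFun.wk {f : Env n → HF ℝ} (h : SFun c f) : SFun c (fun e : Env (n + 1) => f e.tl) := by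
  have := h.reindex (Fin.snoc (fun i => i.castSucc.castSucc) (Fin.last (n + 1)))
  refine this.congr fun e => ?_
  simp only [hd, tl_eq, Fin.snoc_last, Fin.snoc_castSucc]

theorem SFun.var (i : Fin n) : SFun c (fun e => e i) :=
  Sig.eqVar (Fin.last n) i.castSucc

theorem SFun.hd : SFun c (fun e : Env (n + 1) => e.hd) := SFun.var _

theorem SFun.param (j : Fin p) : SFun c (fun _ : Env n => c j) :=
  Sig.eqParam _ j

theorem Sig.subst {k : ℕ} {P : Env k → Prop} (h : Sig c P) (f : Fin k → Env n → HF ℝ)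
    (hf : ∀ i, SFun c (f i)) : Sig c (fun e => P (fun i => f i e)) := by
  -- Generalized to arguments that are context variables or one of `l` functions. The last function
  -- is traded for a fresh context variable, which lowers `l`.
  suffices H : ∀ (l : ℕ) (σ : Fin k → Fin n ⊕ Fin l) (g : Fin l → Env n → HF ℝ)
      (_ : ∀ i, SFun c (g i)), Sig c (fun e => P (fun i => Sum.elim e (fun j => g j e) (σ i))) from
    H k Sum.inr f hf
  intro l
  induction l generalizing n with
  | zero =>
    intro σ g _
    refine (h.reindex (fun i => Sum.elim id Fin.elim0 (σ i))).congr fun e => ?_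
    have : (fun i => e (Sum.elim id Fin.elim0 (σ i))) =
        (fun i => Sum.elim e (fun j => g j e) (σ i)) := by
      funext i
      rcases σ i with j | j
      · rfl
      · exact j.elim0
    rw [this]
  | succ l ih =>
    intro σ g hg
    have h1 := ih (n := n + 1) (f := fun i e => f i e.tl) (fun i => (hf i).wk)
      (fun i => Sum.elim (fun j => Sum.inl j.castSucc)
        (fun j => Fin.lastCases (Sum.inl (Fin.last n)) (fun j => Sum.inr j) j) (σ i))
      (fun j e => g j.castSucc e.tl) (fun j => (hg _).wk)
    have h2 := Sig.comp (P := fun e a => P (fun i => Sum.elim e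
      (fun j => Fin.lastCases a (fun j => g j.castSucc e) j) (σ i))) (f := g (Fin.last l)) ?_ (hg _)
    · refine h2.congr fun e => ?_
      have : (fun i => Sum.elim e (fun j => Fin.lastCases (g (Fin.last l) e)
          (fun j => g j.castSucc e) j) (σ i)) = (fun i => Sum.elim e (fun j => g j e) (σ i)) := by
        funext i
        rcases σ i with j | j
        · rfl
        · refine Fin.lastCases ?_ (fun j => ?_) j <;> simp
      rw [this]
    · refine h1.congr fun e => ?_
      have : ∀ i, Sum.elim e (fun j => g j.castSucc e.tl) (Sum.elim (fun j => Sum.inl j.castSucc)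
          (fun j => Fin.lastCases (Sum.inl (Fin.last n)) (fun j => Sum.inr j) j) (σ i)) =
          Sum.elim e.tl (fun j => Fin.lastCases e.hd (fun j => g j.castSucc e.tl) j) (σ i) := by
        intro i
        rcases σ i with j | j
        · rfl
        · refine Fin.lastCases ?_ (fun j => ?_) j <;> simp [Env.hd]
      simp only [this]

theorem Sig.bex {P : Env n → HF ℝ → Prop} {f : Env n → HF ℝ} (hf : SFun c f)
    (h : Sig c (fun e : Env (n + 1) => P e.tl e.hd)) :
    Sig c (fun e => ∃ a ∈ f e, P e a) := by
  refine Sig.comp (P := fun e b => ∃ a ∈ b, P e a) (Sig.bexVar (Fin.last n)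
    (P := fun e a => P e.tl a) ?_) hf
  refine (h.reindex (Fin.snoc (fun i : Fin n => i.castSucc.castSucc)
    (Fin.last (n + 1)))).congr fun e => ?_
  simp only [Env.hd, tl_eq, Fin.snoc_last, Fin.snoc_castSucc]

theorem Sig.ball {P : Env n → HF ℝ → Prop} {f : Env n → HF ℝ} (hf : SFun c f)
    (h : Sig c (fun e : Env (n + 1) => P e.tl e.hd)) :
    Sig c (fun e => ∀ a ∈ f e, P e a) := by
  refine Sig.comp (P := fun e b => ∀ a ∈ b, P e a) (Sig.ballVar (Fin.last n)
    (P := fun e a => P e.tl a) ?_) hf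
  refine (h.reindex (Fin.snoc (fun i : Fin n => i.castSucc.castSucc)
    (Fin.last (n + 1)))).congr fun e => ?_
  simp only [Env.hd, tl_eq, Fin.snoc_last, Fin.snoc_castSucc]

variable {f g : Env n → HF ℝ}

theorem Sig.eq (hf : SFun c f) (hg : SFun c g) : Sig c (fun e => f e = g e) :=
  (Sig.eqVar (c := c) (0 : Fin 2) 1).subst ![f, g] (Fin.forall_fin_two.mpr ⟨hf, hg⟩)

theorem Sig.ne (hf : SFun c f) (hg : SFun c g) : Sig c (fun e => f e ≠ g e) :=
  (Sig.neVar (c := c) (0 : Fin 2) 1).subst ![f, g] (Fin.forall_fin_two.mpr ⟨hf, hg⟩)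

theorem Sig.mem (hf : SFun c f) (hg : SFun c g) : Sig c (fun e => f e ∈ g e) :=
  (Sig.rel (c := c) HFRel.mem (id : Fin 2 → Fin 2)).subst ![f, g]
    (Fin.forall_fin_two.mpr ⟨hf, hg⟩)

open HF (atomSingleton)

/-! ### Elementary facts on hereditarily finite sets -/

/-- The empty set. -/
def emp : HF ℝ := HF.mk 1 (∅ : Finset (ℝ ⊕ HFLevel ℝ 0))

/-- `a` is the singleton of an atom. -/
def IsAtom (a : HF ℝ) : Prop := ∃ x : ℝ, a = atomSingleton x

theorem isAtom_atomSingleton (x : ℝ) : IsAtom (atomSingleton x) := ⟨x, rfl⟩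

theorem notMem_emp (a : HF ℝ) : a ∉ emp := fun h => by
  obtain ⟨x, -, hx⟩ := HF.mem_mk.mp h
  exact PEmpty.elim x

/-- Atoms are not in the universe of `HF(ℝ)`, so membership cannot tell `{x}` from `∅`. The
relations of `ℝ` have to do this. -/
theorem notMem_atomSingleton (a : HF ℝ) (x : ℝ) : a ∉ atomSingleton x := fun h => by
  obtain ⟨x, -, hx⟩ := HF.mem_mk.mp h
  exact PEmpty.elim x

theorem not_isAtom_emp : ¬ IsAtom emp := by
  rintro ⟨x, hx⟩
  have h := HF.mk_injective 1 hx
  have h' : (Sum.inl x : ℝ ⊕ HFLevel ℝ 0) ∈ (∅ : Finset (ℝ ⊕ HFLevel ℝ 0)) := by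
    change (Sum.inl x : ℝ ⊕ HFLevel ℝ 0) ∈ (show Finset (ℝ ⊕ HFLevel ℝ 0) from ∅)
    rw [show (∅ : Finset (ℝ ⊕ HFLevel ℝ 0)) = {Sum.inl x} from h]
    exact Finset.mem_singleton_self _
  simp at h'

theorem not_isAtom_of_mem {a b : HF ℝ} (h : a ∈ b) : ¬ IsAtom b := by
  rintro ⟨x, rfl⟩
  exact notMem_atomSingleton a x h

theorem mem_induction {P : HF ℝ → Prop} (h : ∀ d, (∀ a ∈ d, P a) → P d) (d : HF ℝ) : P d := by
  obtain ⟨⟨m, x⟩, rfl⟩ := Quot.exists_rep d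
  change P (HF.mk m x)
  induction m with
  | zero => exact PEmpty.elim x
  | succ m ih =>
    refine h _ fun a ha => ?_
    obtain ⟨y, rfl, -⟩ := HF.mem_mk.mp ha
    exact ih y

theorem exists_level (S : Finset (HF ℝ)) : ∃ m, ∀ a ∈ S, ∃ x : HFLevel ℝ m, a = HF.mk m x := by
  classical
  induction S using Finset.induction_on with
  | empty => exact ⟨0, by simp⟩
  | insert a S _ ih =>
    obtain ⟨m, hm⟩ := ih
    obtain ⟨⟨k, x⟩, rfl⟩ := Quot.exists_rep a
    refine ⟨max m k, fun b hb => ?_⟩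
    rcases Finset.mem_insert.mp hb with rfl | hb
    · exact ⟨HF.inclTo (le_max_right _ _) x, (HF.mk_inclTo _ _).symm⟩
    · obtain ⟨y, rfl⟩ := hm b hb
      exact ⟨HF.inclTo (le_max_left _ _) y, (HF.mk_inclTo _ _).symm⟩

/-- Finitely many elements lie in a common level, and the next level contains all finite subsets of
it. This turns finite witnesses into elements of `HF(ℝ)`. -/
theorem exists_mem_iff (S : Finset (HF ℝ)) : ∃ d : HF ℝ, ∀ a, a ∈ d ↔ a ∈ S := by
  classical
  obtain ⟨m, hm⟩ := exists_level S
  let y : Finset (ℝ ⊕ HFLevel ℝ m) :=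
    (S.preimage (HF.mk m) (HF.mk_injective m).injOn).map Function.Embedding.inr
  refine ⟨HF.mk (m + 1) y, fun a => (HF.mem_mk (y := y)).trans ?_⟩
  constructor
  · rintro ⟨x, rfl, hx⟩
    obtain ⟨y, hy, e⟩ := Finset.mem_map.mp hx
    obtain rfl : y = x := Sum.inr_injective e
    exact Finset.mem_preimage.mp hy
  · intro ha
    obtain ⟨x, rfl⟩ := hm a ha
    exact ⟨x, rfl, Finset.mem_map.mpr ⟨x, Finset.mem_preimage.mpr ha, rfl⟩⟩

/-- The real number `x` if `a = {x}`, and `0` if `a` is not of this form. -/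
noncomputable def val (a : HF ℝ) : ℝ :=
  open Classical in if h : IsAtom a then h.choose else 0

@[simp]
theorem val_atomSingleton (x : ℝ) : val (atomSingleton x) = x := by
  have h := isAtom_atomSingleton x
  rw [val, dif_pos h]
  exact HF.atomSingleton_injective h.choose_spec.symm

theorem val_of_not_isAtom {a : HF ℝ} (h : ¬ IsAtom a) : val a = 0 := dif_neg h

/-! ### Definability of the real operations -/

/-- The graph of the real-valued function `f` is Σ-definable with the parameters `c`. -/
def RFun (c : Fin p → HF ℝ) (f : Env n → ℝ) : Prop := SFun c (fun e => atomSingleton (f e))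

theorem RFun.wk {f : Env n → ℝ} (h : RFun c f) : RFun c (fun e : Env (n + 1) => f e.tl) :=
  SFun.wk h

/-- The symbol `≤` in the language of `HF(ℝ)`. -/
def leRel : HFRel orderedRingLang 2 := .rel (Sum.inr leSymb)

theorem relMap_leRel (t : Fin 2 → HF ℝ) :
    Structure.RelMap (L := hfLang orderedRingLang) (M := HF ℝ) leRel t ↔
      ∃ x y : ℝ, t 0 = atomSingleton x ∧ t 1 = atomSingleton y ∧ x ≤ y := by
  constructor
  · rintro ⟨x, hx, h⟩
    exact ⟨x 0, x 1, hx 0, hx 1, h⟩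
  · rintro ⟨x, y, hx, hy, h⟩
    exact ⟨![x, y], Fin.forall_fin_two.mpr ⟨hx, hy⟩, h⟩

theorem Sig.le {f g : Env n → ℝ} (hf : RFun c f) (hg : RFun c g) : Sig c (fun e => f e ≤ g e) := by
  refine ((Sig.rel (c := c) leRel id).subst ![_, _] (Fin.forall_fin_two.mpr ⟨hf, hg⟩)).congr
    fun e => (relMap_leRel _).trans ⟨?_, fun h => ⟨_, _, rfl, rfl, h⟩⟩
  rintro ⟨x, y, hx, hy, h⟩
  rwa [HF.atomSingleton_injective hx, HF.atomSingleton_injective hy]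

theorem Sig.lt {f g : Env n → ℝ} (hf : RFun c f) (hg : RFun c g) : Sig c (fun e => f e < g e) := by
  refine ((Sig.not_rel (c := c) leRel id).subst ![_, _]
    (Fin.forall_fin_two.mpr ⟨hg, hf⟩)).congr fun e => (not_congr (relMap_leRel _)).trans ?_
  rw [← not_le]
  refine not_congr ⟨?_, fun h => ⟨_, _, rfl, rfl, h⟩⟩
  rintro ⟨x, y, hx, hy, h⟩
  rwa [HF.atomSingleton_injective hx, HF.atomSingleton_injective hy]

theorem Sig.req {f g : Env n → ℝ} (hf : RFun c f) (hg : RFun c g) : Sig c (fun e => f e = g e) :=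
  (Sig.eq hf hg).congr fun _ => HF.atomSingleton_injective.eq_iff

theorem Sig.rne {f g : Env n → ℝ} (hf : RFun c f) (hg : RFun c g) : Sig c (fun e => f e ≠ g e) :=
  (Sig.ne hf hg).congr fun _ => HF.atomSingleton_injective.ne_iff

/-- The relation `≤*` holds only between singletons of atoms and is reflexive on them. Hence being
one is an atomic condition, and its negation is Σ as well. -/
theorem isAtom_iff_relMap (a : HF ℝ) :
    Structure.RelMap (L := hfLang orderedRingLang) (M := HF ℝ) leRel ![a, a] ↔ IsAtom a := by
  rw [relMap_leRel]
  exact ⟨fun ⟨x, _, h, _⟩ => ⟨x, h⟩, fun ⟨x, h⟩ => ⟨x, x, h, h, le_rfl⟩⟩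

theorem Sig.isAtom (hf : SFun c f) : Sig c (fun e => IsAtom (f e)) := by
  refine ((Sig.rel (c := c) leRel id).subst ![_, _]
    (Fin.forall_fin_two.mpr ⟨hf, hf⟩)).congr fun e => ?_
  rw [← isAtom_iff_relMap]
  refine iff_of_eq (congrArg _ (funext fun i => ?_))
  fin_cases i <;> rfl

theorem Sig.not_isAtom (hf : SFun c f) : Sig c (fun e => ¬ IsAtom (f e)) := by
  refine ((Sig.not_rel (c := c) leRel id).subst ![_, _]
    (Fin.forall_fin_two.mpr ⟨hf, hf⟩)).congr fun e => ?_
  rw [← isAtom_iff_relMap]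
  refine not_congr (iff_of_eq (congrArg _ (funext fun i => ?_)))
  fin_cases i <;> rfl

/-- A real function given by a function symbol of the language of ordered rings. -/
theorem RFun.fn {k : ℕ} (F : orderedRingLang.Functions k) {f : Fin k → Env n → ℝ}
    (hf : ∀ i, RFun c (f i)) : RFun c (fun e => Structure.funMap F (fun i => f i e)) := by
  unfold RFun SFun
  refine ((Sig.rel (c := c) (HFRel.graph F) id).subst
    (fun i e => Fin.lastCases e.hd (fun j => atomSingleton (f j e.tl)) i)
    fun i => ?_).congr fun e => ?_
  · refine Fin.lastCases ?_ (fun j => ?_) i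
    · simpa only [Fin.lastCases_last] using SFun.hd
    · simp only [Fin.lastCases_castSucc]
      exact (hf j).wk
  · constructor
    · rintro ⟨x, hx, h⟩
      simp only [id, Fin.lastCases_castSucc, Fin.lastCases_last] at hx h
      rw [h]
      congr 2
      exact funext fun i => (HF.atomSingleton_injective (hx i)).symm
    · intro h
      refine ⟨fun i => f i e.tl, fun i => ?_, ?_⟩
      · simp only [id, Fin.lastCases_castSucc]
      · simpa only [id, Fin.lastCases_last] using h

theorem RFun.zero : RFun c (fun _ : Env n => 0) :=
  RFun.fn (Sum.inl ringFunc.zero : orderedRingLang.Functions 0) (f := Fin.elim0) (fun i => i.elim0)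

theorem RFun.one : RFun c (fun _ : Env n => 1) :=
  RFun.fn (Sum.inl ringFunc.one : orderedRingLang.Functions 0) (f := Fin.elim0) (fun i => i.elim0)

section

variable {f g : Env n → ℝ}

theorem RFun.add (hf : RFun c f) (hg : RFun c g) : RFun c (fun e => f e + g e) :=
  RFun.fn (Sum.inl ringFunc.add : orderedRingLang.Functions 2) (f := ![f, g])
    (Fin.forall_fin_two.mpr ⟨hf, hg⟩)

theorem RFun.mul (hf : RFun c f) (hg : RFun c g) : RFun c (fun e => f e * g e) :=
  RFun.fn (Sum.inl ringFunc.mul : orderedRingLang.Functions 2) (f := ![f, g])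
    (Fin.forall_fin_two.mpr ⟨hf, hg⟩)

theorem RFun.natCast (k : ℕ) : RFun c (fun _ : Env n => (k : ℝ)) := by
  induction k with
  | zero => simpa using RFun.zero
  | succ k ih => simpa using ih.add RFun.one

theorem RFun.pow (hf : RFun c f) (k : ℕ) : RFun c (fun e => f e ^ k) := by
  induction k with
  | zero => simpa using RFun.one
  | succ k ih => simpa only [pow_succ] using ih.mul hf

theorem RFun.sum {ι : Type*} (s : Finset ι) {f : ι → Env n → ℝ} (hf : ∀ i ∈ s, RFun c (f i)) :
    RFun c (fun e => ∑ i ∈ s, f i e) := by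
  classical
  induction s using Finset.induction_on with
  | empty => simpa using RFun.zero
  | insert a s ha ih =>
    simpa only [Finset.sum_insert ha] using
      (hf a (by simp)).add (ih fun i hi => hf i (by simp [hi]))

theorem RFun.prod {ι : Type*} (s : Finset ι) {f : ι → Env n → ℝ} (hf : ∀ i ∈ s, RFun c (f i)) :
    RFun c (fun e => ∏ i ∈ s, f i e) := by
  classical
  induction s using Finset.induction_on with
  | empty => simpa using RFun.one
  | insert a s ha ih =>
    simpa only [Finset.prod_insert ha] using
      (hf a (by simp)).mul (ih fun i hi => hf i (by simp [hi]))

/-- Arbitrary real coefficients enter only here, as parameters; natural numbers are generated by `0`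
and `1`. -/
theorem RFun.eval {ι : Type*} (h : MvPolynomial ι ℝ)
    (hc : ∀ m ∈ h.support, atomSingleton (h.coeff m) ∈ Set.range c)
    {x : Env n → ι → ℝ} (hx : ∀ i, RFun c (fun e => x e i)) :
    RFun c (fun e => MvPolynomial.eval (x e) h) := by
  simp only [MvPolynomial.eval_eq]
  refine RFun.sum _ fun m hm => RFun.mul ?_ (RFun.prod _ fun i _ => (hx i).pow _)
  obtain ⟨j, hj⟩ := hc m hm
  rw [RFun, ← hj]
  exact SFun.param j

theorem SFun.ite {P : Env n → Prop} {f g : Env n → HF ℝ} [∀ e, Decidable (P e)] (hP : Sig c P)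
    (hP' : Sig c (fun e => ¬ P e)) (hf : SFun c f) (hg : SFun c g) :
    SFun c (fun e => if P e then f e else g e) := by
  refine ((hP.wk.and (Sig.eq SFun.hd hf.wk)).or (hP'.wk.and (Sig.eq SFun.hd hg.wk))).congr
    fun e => ?_
  by_cases h : P e.tl <;> simp [h]

end

theorem RFun.val (hf : SFun c f) : RFun c (fun e => val (f e)) := by
  classical
  unfold RFun
  refine Sig.congr (SFun.ite (Sig.isAtom hf) (Sig.not_isAtom hf) hf
    (RFun.zero (c := c))) fun e => ?_
  by_cases h : IsAtom (f e.tl)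
  · obtain ⟨x, hx⟩ := h
    simp [hx, isAtom_atomSingleton]
  · simp [h, val_of_not_isAtom h]

theorem RFun.div {f g : Env n → ℝ} (hf : RFun c f) (hg : RFun c g) :
    RFun c (fun e => f e / g e) := by
  unfold RFun SFun
  -- The second alternative encodes the convention `x / 0 = 0`, so that division is total.
  refine Sig.congr (P := fun e : Env (n + 1) => IsAtom e.hd ∧
    ((g e.tl ≠ 0 ∧ SigmaReal.val e.hd * g e.tl = f e.tl) ∨ (g e.tl = 0 ∧ SigmaReal.val e.hd = 0)))
    ((Sig.isAtom SFun.hd).and (((Sig.rne hg.wk RFun.zero).and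
      (Sig.req ((RFun.val SFun.hd).mul hg.wk) hf.wk)).or
      ((Sig.req hg.wk RFun.zero).and (Sig.req (RFun.val SFun.hd) RFun.zero)))) fun e => ?_
  beta_reduce
  constructor
  · rintro ⟨⟨x, hx⟩, ⟨h, h'⟩ | ⟨h, h'⟩⟩
    · rw [hx, val_atomSingleton] at h'
      rw [hx, ← h', mul_div_cancel_right₀ _ h]
    · rw [hx, val_atomSingleton] at h'
      rw [hx, h', h, div_zero]
  · intro h
    rw [h]
    refine ⟨isAtom_atomSingleton _, ?_⟩
    by_cases h0 : g e.tl = 0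
    · simp [h0]
    · simp [h0]

/-! ### Heads and tails -/

/-- The unique element of `d` with the property `Q`, or `∅` if there is no such element. -/
noncomputable def the (Q : HF ℝ → Prop) (d : HF ℝ) : HF ℝ :=
  open Classical in if h : ∃ a ∈ d, Q a ∧ ∀ z ∈ d, Q z → z = a then h.choose else emp

section

variable {Q : HF ℝ → Prop} {d a : HF ℝ}

theorem the_eq (ha : a ∈ d) (hQ : Q a) (hu : ∀ z ∈ d, Q z → z = a) : the Q d = a := by
  have h : ∃ a ∈ d, Q a ∧ ∀ z ∈ d, Q z → z = a := ⟨a, ha, hQ, hu⟩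
  rw [the, dif_pos h]
  exact hu _ h.choose_spec.1 h.choose_spec.2.1

theorem the_of_not (h : ¬ ∃ a ∈ d, Q a ∧ ∀ z ∈ d, Q z → z = a) : the Q d = emp := dif_neg h

theorem the_mem_or : (the Q d ∈ d ∧ Q (the Q d)) ∨ the Q d = emp := by
  by_cases h : ∃ a ∈ d, Q a ∧ ∀ z ∈ d, Q z → z = a
  · obtain ⟨a, ha, hQ, hu⟩ := h
    rw [the_eq ha hQ hu]
    exact Or.inl ⟨ha, hQ⟩
  · exact Or.inr (the_of_not h)

/-- Failure of unique existence is spelled out positively, as no witness or two different ones. Only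
bounded quantifiers over `Q` and `¬ Q` remain, so it suffices that both of these are Σ. -/
theorem eq_the_iff : a = the Q d ↔ (a ∈ d ∧ Q a ∧ ∀ z ∈ d, ¬ Q z ∨ z = a) ∨
    (a = emp ∧ ((∀ z ∈ d, ¬ Q z) ∨ ∃ z ∈ d, ∃ w ∈ d, Q z ∧ Q w ∧ z ≠ w)) := by
  by_cases h : ∃ a ∈ d, Q a ∧ ∀ z ∈ d, Q z → z = a
  · obtain ⟨b, hb, hQ, hu⟩ := h
    rw [the_eq hb hQ hu]
    constructor
    · rintro rfl
      exact Or.inl ⟨hb, hQ, fun z hz => by grind⟩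
    · grind
  · rw [the_of_not h]
    grind

end

theorem SFun.the {Q : HF ℝ → Prop} (hQ : Sig c (fun e : Env 1 => Q (e 0)))
    (hQ' : Sig c (fun e : Env 1 => ¬ Q (e 0))) (h0 : emp ∈ Set.range c) (hf : SFun c f) :
    SFun c (fun e => the Q (f e)) := by
  have q : ∀ {m : ℕ} {g : Env m → HF ℝ}, SFun c g → Sig c (fun e => Q (g e)) :=
    fun hg => hQ.subst (fun _ => _) (fun _ => hg)
  have q' : ∀ {m : ℕ} {g : Env m → HF ℝ}, SFun c g → Sig c (fun e => ¬ Q (g e)) :=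
    fun hg => hQ'.subst (fun _ => _) (fun _ => hg)
  obtain ⟨j, hj⟩ := h0
  have hd0 : SFun c (fun e : Env (n + 1) => e.hd) := SFun.hd
  have hf1 := hf.wk
  refine Sig.congr (P := fun e => (e.hd ∈ f e.tl ∧ Q e.hd ∧ ∀ z ∈ f e.tl, ¬ Q z ∨ z = e.hd) ∨
    (e.hd = c j ∧ ((∀ z ∈ f e.tl, ¬ Q z) ∨ ∃ z ∈ f e.tl, ∃ w ∈ f e.tl, Q z ∧ Q w ∧ z ≠ w)))
    ?_ fun e => by rw [hj, eq_the_iff]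
  exact ((Sig.mem hd0 hf1).and ((q hd0).and (Sig.ball hf1 ((q' SFun.hd).or
      (Sig.eq SFun.hd hd0.wk))))).or
    ((Sig.eq hd0 (SFun.param j)).and ((Sig.ball hf1 (q' SFun.hd)).or
      (Sig.bex hf1 (Sig.bex hf1.wk ((q SFun.hd.wk).and ((q SFun.hd).and
        (Sig.ne SFun.hd.wk SFun.hd)))))))

/-- The first entry of a list `{{x}, t}`, as a real number. -/
noncomputable def head (d : HF ℝ) : ℝ := val (the IsAtom d)

/-- The rest `t` of a list `{{x}, t}`. -/
noncomputable def tail (d : HF ℝ) : HF ℝ := the (fun a => ¬ IsAtom a) d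

theorem RFun.head (h0 : emp ∈ Set.range c) (hf : SFun c f) : RFun c (fun e => head (f e)) :=
  RFun.val (SFun.the (Sig.isAtom (SFun.var 0)) (Sig.not_isAtom (SFun.var 0)) h0 hf)

theorem SFun.tail (h0 : emp ∈ Set.range c) (hf : SFun c f) : SFun c (fun e => tail (f e)) :=
  SFun.the (Sig.not_isAtom (SFun.var 0))
    ((Sig.isAtom (SFun.var 0)).congr fun _ => not_not.symm) h0 hf

theorem SFun.iterate_tail (h0 : emp ∈ Set.range c) (hf : SFun c f) (k : ℕ) :
    SFun c (fun e => SigmaReal.tail^[k] (f e)) := by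
  induction k with
  | zero => exact hf
  | succ k ih => simpa only [Function.iterate_succ_apply'] using ih.tail h0

theorem not_isAtom_tail (d : HF ℝ) : ¬ IsAtom (tail d) := by
  rcases the_mem_or (Q := fun a => ¬ IsAtom a) (d := d) with h | h
  · exact h.2
  · rw [tail, h]
    exact not_isAtom_emp

theorem tail_mem_or (d : HF ℝ) : tail d ∈ d ∨ tail d = emp :=
  the_mem_or.imp_left And.left

theorem the_of_forall_notMem {Q : HF ℝ → Prop} {d : HF ℝ} (h : ∀ a, a ∉ d) : the Q d = emp :=
  the_of_not fun ⟨a, ha, _⟩ => h a ha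

@[simp]
theorem head_emp : head emp = 0 := by
  rw [head, the_of_forall_notMem notMem_emp, val_of_not_isAtom not_isAtom_emp]

@[simp]
theorem tail_emp : tail emp = emp := the_of_forall_notMem notMem_emp

@[simp]
theorem head_atomSingleton (x : ℝ) : head (atomSingleton x) = 0 := by
  rw [head, the_of_forall_notMem fun a => notMem_atomSingleton a x,
    val_of_not_isAtom not_isAtom_emp]

/-- In `{{x}, t}` the two elements are told apart by `IsAtom`, which is why `t` must not be the
singleton of an atom. -/
theorem exists_cons (x : ℝ) {t : HF ℝ} (ht : ¬ IsAtom t) :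
    ∃ d, ¬ IsAtom d ∧ d ≠ emp ∧ head d = x ∧ tail d = t := by
  classical
  obtain ⟨d, hd⟩ := exists_mem_iff {atomSingleton x, t}
  have h1 : atomSingleton x ∈ d := by simp [hd]
  have h2 : t ∈ d := by simp [hd]
  refine ⟨d, not_isAtom_of_mem h1, ?_, ?_, ?_⟩
  · rintro rfl
    exact notMem_emp _ h1
  · rw [head, the_eq h1 (isAtom_atomSingleton x), val_atomSingleton]
    intro z hz hA
    have : z = atomSingleton x ∨ z = t := by simpa [hd] using hz
    exact this.resolve_right fun e => ht (e ▸ hA)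
  · refine the_eq h2 ht fun z hz hA => ?_
    have : z = atomSingleton x ∨ z = t := by simpa [hd] using hz
    exact this.resolve_left fun e => hA (e ▸ isAtom_atomSingleton x)

/-- A tail is an element or `∅`, so this follows from ∈-induction. Every element of `HF(ℝ)` can thus
be read as a finite list, with no well-formedness condition. -/
theorem tail_induction {P : HF ℝ → Prop} (h0 : P emp) (h1 : ∀ d, d ≠ emp → P (tail d) → P d)
    (d : HF ℝ) : P d := by
  induction d using mem_induction with
  | h d ih =>
    by_cases hd : d = emp
    · exact hd ▸ h0
    · refine h1 d hd ?_
      rcases tail_mem_or d with h | h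
      · exact ih _ h
      · exact h ▸ h0

/-! ### Tuples -/

/-- The component with the label `i` of a tuple, which is a set of lists `{{i}, t}`. -/
noncomputable def field (i : ℕ) (d : HF ℝ) : HF ℝ := tail (the (fun a => head a = i) d)

theorem SFun.field (h0 : emp ∈ Set.range c) (i : ℕ) (hf : SFun c f) :
    SFun c (fun e => field i (f e)) :=
  SFun.tail h0 (SFun.the (Sig.req (RFun.head h0 (SFun.var 0)) (RFun.natCast i))
    (Sig.rne (RFun.head h0 (SFun.var 0)) (RFun.natCast i)) h0 hf)

theorem not_isAtom_field (i : ℕ) (d : HF ℝ) : ¬ IsAtom (field i d) := not_isAtom_tail _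

theorem exists_tuple (q : ℝ) {k : ℕ} (t : Fin k → HF ℝ) (ht : ∀ i, ¬ IsAtom (t i)) :
    ∃ d, head d = q ∧ ∀ i : Fin k, field (i + 1) d = t i := by
  classical
  choose w hwA _ hwh hwt using fun i : Fin k => exists_cons ((i : ℕ) + 1 : ℕ) (ht i)
  obtain ⟨d, hd⟩ := exists_mem_iff (insert (atomSingleton q) (Finset.univ.image w))
  -- The singleton `{q}` also lies in `d` and has the default head `0`; labels starting at `1` keep
  -- it from being taken for a field.
  have hmem : ∀ {z}, z ∈ d → z = atomSingleton q ∨ ∃ i, w i = z := fun hz => by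
    simpa [hd] using hz
  refine ⟨d, ?_, fun i => ?_⟩
  · rw [head, the_eq (a := atomSingleton q) (by simp [hd]) (isAtom_atomSingleton q),
      val_atomSingleton]
    intro z hz hA
    rcases hmem hz with h | ⟨i, rfl⟩
    · exact h
    · exact (hwA i hA).elim
  · rw [field, the_eq (a := w i) (by simp [hd]) (hwh i), hwt]
    intro z hz hh
    rcases hmem hz with rfl | ⟨j, rfl⟩
    · rw [head_atomSingleton] at hh
      exact absurd hh (by positivity)
    · rw [hwh] at hh
      have : (j : ℕ) + 1 = i + 1 := by exact_mod_cast hh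
      rw [show j = i from Fin.ext (by omega)]

open BSS

/-! ### Tapes -/

/-- The tape with the coordinates `0, -1, -2, …` in the list `L` and `1, 2, 3, …` in `R`. -/
noncomputable def tape (L R : HF ℝ) (i : ℤ) : ℝ :=
  if 1 ≤ i then head (tail^[(i - 1).toNat] R) else head (tail^[(-i).toNat] L)

theorem tape_natCast_add_one (L R : HF ℝ) (j : ℕ) :
    tape L R ((j : ℤ) + 1) = head (tail^[j] R) := by
  rw [tape, if_pos (by omega)]
  congr 2
  simp

theorem tape_neg_natCast (L R : HF ℝ) (j : ℕ) : tape L R (-(j : ℤ)) = head (tail^[j] L) := by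
  rw [tape, if_neg (by omega)]
  congr 2
  simp

theorem int_cases (i : ℤ) : (∃ j : ℕ, i = j + 1) ∨ ∃ j : ℕ, i = -(j : ℤ) := by
  by_cases h : 1 ≤ i
  · exact Or.inl ⟨(i - 1).toNat, by omega⟩
  · exact Or.inr ⟨(-i).toNat, by omega⟩

theorem RFun.tape (h0 : emp ∈ Set.range c) {f g : Env n → HF ℝ} (hf : SFun c f) (hg : SFun c g)
    (i : ℤ) : RFun c (fun e => tape (f e) (g e) i) := by
  rcases int_cases i with ⟨j, rfl⟩ | ⟨j, rfl⟩
  · simpa only [tape_natCast_add_one] using RFun.head h0 (hg.iterate_tail h0 j)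
  · simpa only [tape_neg_natCast] using RFun.head h0 (hf.iterate_tail h0 j)

/-- A left shift moves the first entry of `R` onto `L`. Coordinate `0`, where the halves meet, is a
case of its own. -/
theorem tape_shift {L R L' R' : HF ℝ} (h1 : R' = tail R) (h2 : tail L' = L)
    (h3 : head L' = head R) (i : ℤ) : tape L' R' i = tape L R (i + 1) := by
  rcases int_cases i with ⟨j, rfl⟩ | ⟨_ | j, rfl⟩
  · rw [tape_natCast_add_one, h1, ← Function.iterate_succ_apply, ← tape_natCast_add_one L]
    push_cast
    rfl
  · have e1 := tape_neg_natCast L' R' 0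
    have e2 := tape_natCast_add_one L R 0
    simp only [Nat.cast_zero, zero_add, neg_zero, Function.iterate_zero, id] at e1 e2 ⊢
    rw [e1, h3, e2]
  · rw [tape_neg_natCast, Function.iterate_succ_apply, h2, ← tape_neg_natCast L R]
    congr 1
    push_cast
    ring

theorem exists_prefix (K : ℕ) (f : ℕ → ℝ) {t : HF ℝ} (ht : ¬ IsAtom t) :
    ∃ d, ¬ IsAtom d ∧ (∀ j < K, head (tail^[j] d) = f j) ∧ tail^[K] d = t := by
  induction K generalizing f with
  | zero => exact ⟨t, ht, by simp, rfl⟩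
  | succ K ih =>
    obtain ⟨d, hd, h1, h2⟩ := ih (fun j => f (j + 1))
    obtain ⟨d', hd', -, h3, h4⟩ := exists_cons (f 0) hd
    refine ⟨d', hd', fun j hj => ?_, by rw [Function.iterate_succ_apply, h4, h2]⟩
    rcases j with _ | j
    · exact h3
    · rw [Function.iterate_succ_apply, h4, h1 j (by omega)]

theorem not_isAtom_iterate_tail (K : ℕ) {t : HF ℝ} (ht : ¬ IsAtom t) : ¬ IsAtom (tail^[K] t) := by
  cases K with
  | zero => exact ht
  | succ K =>
    rw [Function.iterate_succ_apply']
    exact not_isAtom_tail _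

/-- The tape `(L', R')` is `G` in the window `(-K, K]` and the same as `(L, R)` elsewhere. -/
def Update (K : ℕ) (G : ℤ → ℝ) (L R L' R' : HF ℝ) : Prop :=
  (∀ i ∈ Finset.Ioc (-(K : ℤ)) K, tape L' R' i = G i) ∧ tail^[K] L' = tail^[K] L ∧
    tail^[K] R' = tail^[K] R

/-- Outside the window the position within a half is at least `K`. Two equations between `K`-th
tails therefore control infinitely many coordinates. -/
theorem Update.tape_eq {K : ℕ} {G : ℤ → ℝ} {L R L' R' : HF ℝ} (h : Update K G L R L' R') {i : ℤ}
    (hi : i ∉ Finset.Ioc (-(K : ℤ)) K) : tape L' R' i = tape L R i := by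
  rw [Finset.mem_Ioc] at hi
  rcases int_cases i with ⟨j, rfl⟩ | ⟨j, rfl⟩
  · rw [tape_natCast_add_one, tape_natCast_add_one]
    obtain ⟨l, rfl⟩ : ∃ l, j = l + K := ⟨j - K, by omega⟩
    rw [Function.iterate_add_apply, h.2.2, Function.iterate_add_apply]
  · rw [tape_neg_natCast, tape_neg_natCast]
    obtain ⟨l, rfl⟩ : ∃ l, j = l + K := ⟨j - K, by omega⟩
    rw [Function.iterate_add_apply, h.2.1, Function.iterate_add_apply]

theorem exists_update (K : ℕ) (G : ℤ → ℝ) {L R : HF ℝ} (hL : ¬ IsAtom L) (hR : ¬ IsAtom R) :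
    ∃ L' R', ¬ IsAtom L' ∧ ¬ IsAtom R' ∧ Update K G L R L' R' := by
  obtain ⟨L', hL', h1, h2⟩ := exists_prefix K (fun j => G (-(j : ℤ)))
    (not_isAtom_iterate_tail K hL)
  obtain ⟨R', hR', h3, h4⟩ := exists_prefix K (fun j => G ((j : ℤ) + 1))
    (not_isAtom_iterate_tail K hR)
  refine ⟨L', R', hL', hR', fun i hi => ?_, h2, h4⟩
  rw [Finset.mem_Ioc] at hi
  rcases int_cases i with ⟨j, rfl⟩ | ⟨j, rfl⟩
  · rw [tape_natCast_add_one, h3 j (by omega)]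
  · rw [tape_neg_natCast, h1 j (by omega)]

theorem Sig.update (h0 : emp ∈ Set.range c) (K : ℕ) {G : Env n → ℤ → ℝ}
    {L R L' R' : Env n → HF ℝ} (hG : ∀ i, RFun c (fun e => G e i)) (hL : SFun c L)
    (hR : SFun c R) (hL' : SFun c L') (hR' : SFun c R') :
    Sig c (fun e => Update K (G e) (L e) (R e) (L' e) (R' e)) :=
  (Sig.forall_finset _ fun i _ => Sig.req (RFun.tape h0 hL' hR' i) (hG i)).and
    ((Sig.eq (hL'.iterate_tail h0 K) (hL.iterate_tail h0 K)).and
      (Sig.eq (hR'.iterate_tail h0 K) (hR.iterate_tail h0 K)))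

/-! ### Steps of a machine -/

/-- A bound of the window of the tape that a rational map changes. -/
def window (g : RationalMap) : ℕ := g.coords.sup Int.natAbs + 1

/-- The window `(-K, K]` omits `-K`; the `+ 1` in `window` makes room for the most negative
coordinate. -/
theorem mem_window {g : RationalMap} {i : ℤ} (hi : i ∈ g.coords) :
    i ∈ Finset.Ioc (-(window g : ℤ)) (window g) := by
  have := Finset.le_sup (f := Int.natAbs) hi
  rw [Finset.mem_Ioc, window]
  omega

/-- The coordinate `i` of the value of a rational map. -/
noncomputable def coordValue (g : RationalMap) (x : ℤ → ℝ) (i : ℤ) : ℝ :=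
  if i ∈ g.coords then MvPolynomial.eval x (g.num i) / MvPolynomial.eval x (g.den i) else x i

/-- The transitions at a node between configurations, where a configuration has the node as its
head, and as its fields `1` and `2` the two halves of the tape. -/
def NodeStep {k : ℕ} : Node (Fin k) → HF ℝ → HF ℝ → Prop
  | .input _, _, _ => False
  | .output, _, _ => False
  | .computation g next, d, d' => head d' = (next : ℕ) ∧
      Update (window g) (coordValue g (tape (field 1 d) (field 2 d)))
        (field 1 d) (field 2 d) (field 1 d') (field 2 d')
  | .branch h next0 next1, d, d' =>
      ((0 ≤ MvPolynomial.eval (tape (field 1 d) (field 2 d)) h ∧ head d' = (next1 : ℕ)) ∨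
        (MvPolynomial.eval (tape (field 1 d) (field 2 d)) h < 0 ∧ head d' = (next0 : ℕ))) ∧
      field 1 d' = field 1 d ∧ field 2 d' = field 2 d
  | .shift .left next, d, d' => head d' = (next : ℕ) ∧ field 2 d' = tail (field 2 d) ∧
      tail (field 1 d') = field 1 d ∧ head (field 1 d') = head (field 2 d)
  | .shift .right next, d, d' => head d' = (next : ℕ) ∧ field 1 d' = tail (field 1 d) ∧
      tail (field 2 d') = field 2 d ∧ head (field 2 d') = head (field 1 d)

open Classical in
/-- The polynomials that occur at a node. -/
noncomputable def nodePolys {k : ℕ} : Node (Fin k) → Finset (MvPolynomial ℤ ℝ)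
  | .computation g _ => g.coords.image g.num ∪ g.coords.image g.den
  | .branch h _ _ => {h}
  | _ => ∅

theorem RFun.coordValue (h0 : emp ∈ Set.range c) (g : RationalMap) {L R : Env n → HF ℝ}
    (hc : ∀ h ∈ g.coords.image g.num ∪ g.coords.image g.den, ∀ m ∈ h.support,
      atomSingleton (h.coeff m) ∈ Set.range c) (hL : SFun c L) (hR : SFun c R) (i : ℤ) :
    RFun c (fun e => coordValue g (SigmaReal.tape (L e) (R e)) i) := by
  unfold SigmaReal.coordValue
  by_cases hi : i ∈ g.coords
  · simp only [if_pos hi]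
    have h1 : g.num i ∈ g.coords.image g.num ∪ g.coords.image g.den :=
      Finset.mem_union_left _ (Finset.mem_image_of_mem _ hi)
    have h2 : g.den i ∈ g.coords.image g.num ∪ g.coords.image g.den :=
      Finset.mem_union_right _ (Finset.mem_image_of_mem _ hi)
    exact (RFun.eval _ (hc _ h1) (RFun.tape h0 hL hR)).div
      (RFun.eval _ (hc _ h2) (RFun.tape h0 hL hR))
  · simp only [if_neg hi]
    exact RFun.tape h0 hL hR i

theorem Sig.nodeStep (h0 : emp ∈ Set.range c) {k : ℕ} (ν : Node (Fin k))
    (hc : ∀ h ∈ nodePolys ν, ∀ m ∈ h.support, atomSingleton (h.coeff m) ∈ Set.range c)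
    {f g : Env n → HF ℝ} (hf : SFun c f) (hg : SFun c g) :
    Sig c (fun e => NodeStep ν (f e) (g e)) := by
  have L := SFun.field h0 1 hf
  have R := SFun.field h0 2 hf
  have L' := SFun.field h0 1 hg
  have R' := SFun.field h0 2 hg
  have N : ∀ next : Fin k, Sig c (fun e => head (g e) = (next : ℕ)) := fun next =>
    Sig.req (RFun.head h0 hg) (RFun.natCast _)
  match ν with
  | .input _ => exact Sig.false
  | .output => exact Sig.false
  | .computation r next =>
    exact (N next).and (Sig.update h0 _ (RFun.coordValue h0 r (by unfold nodePolys at hc; convert hc) L R) L R L' R')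
  | .branch h next0 next1 =>
    have E := RFun.eval h (hc h (Finset.mem_singleton_self h)) (RFun.tape h0 L R)
    exact (((Sig.le RFun.zero E).and (N next1)).or ((Sig.lt E RFun.zero).and (N next0))).and
      ((Sig.eq L' L).and (Sig.eq R' R))
  | .shift .left next =>
    exact (N next).and ((Sig.eq R' (SFun.tail h0 R)).and ((Sig.eq (SFun.tail h0 L') L).and
      (Sig.req (RFun.head h0 L') (RFun.head h0 R))))
  | .shift .right next =>
    exact (N next).and ((Sig.eq L' (SFun.tail h0 L)).and ((Sig.eq (SFun.tail h0 R') R).and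
      (Sig.req (RFun.head h0 R') (RFun.head h0 L))))

/-- The configuration `d` in `HF(ℝ)` represents the configuration `a` of a machine. -/
def Reps {k : ℕ} (d : HF ℝ) (a : Fin k × State) : Prop :=
  head d = (a.1 : ℕ) ∧ ∀ i, tape (field 1 d) (field 2 d) i = a.2 i

theorem exists_conf (k : ℕ) {L R : HF ℝ} (hL : ¬ IsAtom L) (hR : ¬ IsAtom R) :
    ∃ d, head d = k ∧ field 1 d = L ∧ field 2 d = R := by
  obtain ⟨d, h1, h2⟩ := exists_tuple k ![L, R] (Fin.forall_fin_two.mpr ⟨hL, hR⟩)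
  exact ⟨d, h1, h2 0, h2 1⟩

theorem Reps.tape_eq {k : ℕ} {d : HF ℝ} {a : Fin k × State} (h : Reps d a) :
    tape (field 1 d) (field 2 d) = fun i => a.2 i := funext h.2

theorem tape_shift_right {L R L' R' : HF ℝ} (h1 : L' = tail L) (h2 : tail R' = R)
    (h3 : head R' = head L) (i : ℤ) : tape L' R' i = tape L R (i - 1) := by
  rcases int_cases i with ⟨_ | j, rfl⟩ | ⟨j, rfl⟩
  · have e1 := tape_natCast_add_one L' R' 0
    have e2 := tape_neg_natCast L R 0
    simp only [Nat.cast_zero, zero_add, neg_zero, Function.iterate_zero, id] at e1 e2 ⊢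
    rw [e1, h3, sub_self, e2]
  · rw [tape_natCast_add_one, Function.iterate_succ_apply, h2, ← tape_natCast_add_one L R]
    congr 1
    push_cast
    ring
  · rw [tape_neg_natCast, h1, ← Function.iterate_succ_apply, ← tape_neg_natCast L R]
    congr 1
    push_cast
    ring

/-- The successor of a code is not unique, but what it represents is. Poles need no clause in
`NodeStep`, because only steps that the machine makes are compared. -/
theorem NodeStep.reps {M : Machine} {a b : Fin M.size × State} (hab : M.Step a b) {d d' : HF ℝ}
    (hd : Reps d a) (h : NodeStep (M.node a.1) d d') : Reps d' b := by
  cases hab with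
  | @computation η η' g x hη hx =>
    rw [show M.node _ = _ from hη] at h
    refine ⟨h.1, fun i => ?_⟩
    have h2 := h.2
    rw [hd.tape_eq] at h2
    by_cases hi : i ∈ Finset.Ioc (-(window g : ℤ)) (window g)
    · exact h2.1 i hi
    · rw [h2.tape_eq hi, hd.2]
      exact (if_neg fun h' => hi (mem_window h')).symm
  | branch_nonneg hη hx =>
    rw [show M.node _ = _ from hη] at h
    obtain ⟨h1, h2, h3⟩ := h
    rw [hd.tape_eq] at h1
    refine ⟨?_, fun i => by rw [h2, h3, hd.2]⟩
    exact (h1.resolve_right fun h => absurd h.1 (not_lt.mpr hx)).2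
  | branch_neg hη hx =>
    rw [show M.node _ = _ from hη] at h
    obtain ⟨h1, h2, h3⟩ := h
    rw [hd.tape_eq] at h1
    refine ⟨?_, fun i => by rw [h2, h3, hd.2]⟩
    exact (h1.resolve_left fun h => absurd h.1 (not_le.mpr hx)).2
  | shift_left hη =>
    rw [show M.node _ = _ from hη] at h
    obtain ⟨h1, h2, h3, h4⟩ := h
    exact ⟨h1, fun i => by rw [tape_shift h2 h3 h4, hd.2, shiftLeft_apply]⟩
  | shift_right hη =>
    rw [show M.node _ = _ from hη] at h
    obtain ⟨h1, h2, h3, h4⟩ := h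
    exact ⟨h1, fun i => by rw [tape_shift_right h2 h3 h4, hd.2, shiftRight_apply]⟩

theorem exists_nodeStep {M : Machine} {a b : Fin M.size × State} (hab : M.Step a b) {d : HF ℝ}
    (hd : Reps d a) : ∃ d', NodeStep (M.node a.1) d d' := by
  have hL := not_isAtom_field 1 d
  have hR := not_isAtom_field 2 d
  have e := hd.tape_eq
  cases hab with
  | @computation η η' g x hη hx =>
    obtain ⟨L', R', hL', hR', hU⟩ := exists_update (window g)
      (coordValue g (tape (field 1 d) (field 2 d))) hL hR
    obtain ⟨d', h1, rfl, rfl⟩ := exists_conf η' hL' hR'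
    refine ⟨d', ?_⟩
    rw [show M.node _ = _ from hη]
    exact ⟨h1, hU⟩
  | @branch_nonneg η η0 η1 h x hη hx =>
    obtain ⟨d', h1, h2, h3⟩ := exists_conf η1 hL hR
    refine ⟨d', ?_⟩
    rw [show M.node _ = _ from hη]
    refine ⟨Or.inl ⟨?_, h1⟩, h2, h3⟩
    rw [e]
    exact hx
  | @branch_neg η η0 η1 h x hη hx =>
    obtain ⟨d', h1, h2, h3⟩ := exists_conf η0 hL hR
    refine ⟨d', ?_⟩
    rw [show M.node _ = _ from hη]
    refine ⟨Or.inr ⟨?_, h1⟩, h2, h3⟩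
    rw [e]
    exact hx
  | @shift_left η η' x hη =>
    obtain ⟨L', hL', -, h1, h2⟩ := exists_cons (head (field 2 d)) hL
    obtain ⟨d', h3, h4, h5⟩ := exists_conf η' hL' (not_isAtom_tail (field 2 d))
    refine ⟨d', ?_⟩
    rw [show M.node _ = _ from hη]
    exact ⟨h3, h5, h4 ▸ h2, h4 ▸ h1⟩
  | @shift_right η η' x hη =>
    obtain ⟨R', hR', -, h1, h2⟩ := exists_cons (head (field 1 d)) hR
    obtain ⟨d', h3, h4, h5⟩ := exists_conf η' (not_isAtom_tail (field 1 d)) hR'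
    refine ⟨d', ?_⟩
    rw [show M.node _ = _ from hη]
    exact ⟨h3, h4, h5 ▸ h2, h5 ▸ h1⟩

/-! ### Halting computations -/

/-- The configuration `d` is at an output node, with `b` as the first output entry. -/
def Halted (M : Machine) (b : ℝ) (d : HF ℝ) : Prop :=
  ∃ η : Fin M.size, head d = ((η : ℕ) : ℝ) ∧ M.node η = .output ∧ head (field 2 d) = b

/-- The transition relation of the machine `M` between configurations in `HF(ℝ)`. -/
def HFStep (M : Machine) (d d' : HF ℝ) : Prop :=
  ∃ η : Fin M.size, head d = ((η : ℕ) : ℝ) ∧ NodeStep (M.node η) d d'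

/-- There is a finite set of configurations with the tape `(L, R)` at the first node in it that is
closed under transitions and in which every halted configuration has the output entry `b`. -/
def Accepts (M : Machine) (b : ℝ) (L R : HF ℝ) : Prop :=
  ∃ next, M.node M.start = .input next ∧ ∃ T : HF ℝ,
    (∃ d ∈ T, head d = ((next : ℕ) : ℝ) ∧ field 1 d = L ∧ field 2 d = R) ∧
    ∀ d ∈ T, Halted M b d ∨ ∃ d' ∈ T, HFStep M d d'

/-- The coefficients of the polynomials of `M` are among the parameters `c`. -/
def HasCoeffs (c : Fin p → HF ℝ) (M : Machine) : Prop :=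
  ∀ η, ∀ h ∈ nodePolys (M.node η), ∀ m ∈ h.support, atomSingleton (h.coeff m) ∈ Set.range c

/-- The graph of `M` is fixed outside the formula: quantifiers over nodes become finite
disjunctions, and conditions on the type of a node become constants. -/
theorem Sig.accepts (h0 : emp ∈ Set.range c) {M : Machine} (hM : HasCoeffs c M) (b : ℕ)
    {L R : Env n → HF ℝ} (hL : SFun c L) (hR : SFun c R) :
    Sig c (fun e => Accepts M b (L e) (R e)) := by
  refine Sig.exists_fin fun next => Sig.of_const.and (Sig.ex (Sig.and ?_ ?_))
  · exact Sig.bex SFun.hd ((Sig.req (RFun.head h0 SFun.hd) (RFun.natCast _)).and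
      ((Sig.eq (SFun.field h0 1 SFun.hd) hL.wk.wk).and
        (Sig.eq (SFun.field h0 2 SFun.hd) hR.wk.wk)))
  · refine Sig.ball SFun.hd (Sig.or ?_ ?_)
    · exact Sig.exists_fin fun η => (Sig.req (RFun.head h0 SFun.hd) (RFun.natCast _)).and
        (Sig.of_const.and (Sig.req (RFun.head h0 (SFun.field h0 2 SFun.hd)) (RFun.natCast _)))
    · exact Sig.bex SFun.hd.wk (Sig.exists_fin fun η =>
        (Sig.req (RFun.head h0 SFun.hd.wk) (RFun.natCast _)).and
          (Sig.nodeStep h0 _ (hM η) SFun.hd.wk SFun.hd))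

theorem Reps.node_eq {k : ℕ} {d : HF ℝ} {a : Fin k × State} (h : Reps d a) {η : Fin k}
    (hη : head d = ((η : ℕ) : ℝ)) : η = a.1 := by
  rw [h.1] at hη
  exact Fin.ext (by exact_mod_cast hη.symm)

theorem Reps.head_eq {k : ℕ} {d : HF ℝ} {a : Fin k × State} (h : Reps d a) :
    head (field 2 d) = a.2 1 := by
  rw [← h.2]
  simpa using (tape_natCast_add_one (field 1 d) (field 2 d) 0).symm

/-- Induction along the true run. A member of `T` that represents a non-output configuration cannot
be halted, so its successor in `T` represents the next configuration; at the end an output node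
allows no successor. -/
theorem output_of_closed {M : Machine} {b : ℝ} {T : HF ℝ}
    (hT : ∀ d ∈ T, Halted M b d ∨ ∃ d' ∈ T, HFStep M d d') {a a' : Fin M.size × State}
    (haa : Relation.ReflTransGen M.Step a a') (ha' : M.node a'.1 = .output) {d : HF ℝ} (hd : d ∈ T)
    (hda : Reps d a) : a'.2 1 = b := by
  induction haa using Relation.ReflTransGen.head_induction_on generalizing d with
  | refl =>
    rcases hT d hd with ⟨η, hη, hout, hb⟩ | ⟨d', hd', η, hη, hs⟩
    · rw [← hb, hda.head_eq]
    · rw [hda.node_eq hη, ha'] at hs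
      exact hs.elim
  | head hab _ ih =>
    rcases hT d hd with ⟨η, hη, hout, hb⟩ | ⟨d', hd', η, hη, hs⟩
    · rw [hda.node_eq hη] at hout
      exact (Machine.no_step hout hab).elim
    · rw [hda.node_eq hη] at hs
      exact ih hd' (hs.reps hab hda)

theorem exists_closed {M : Machine} {a a' : Fin M.size × State}
    (haa : Relation.ReflTransGen M.Step a a') (ha' : M.node a'.1 = .output) {d : HF ℝ}
    (hda : Reps d a) :
    ∃ T : Finset (HF ℝ), d ∈ T ∧ ∀ d ∈ T, Halted M (a'.2 1) d ∨ ∃ d' ∈ T, HFStep M d d' := by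
  classical
  induction haa using Relation.ReflTransGen.head_induction_on generalizing d with
  | refl =>
    refine ⟨{d}, by simp, fun d' hd' => Or.inl ?_⟩
    obtain rfl := Finset.mem_singleton.mp hd'
    exact ⟨_, hda.1, ha', hda.head_eq⟩
  | head hab _ ih =>
    obtain ⟨d', hs⟩ := exists_nodeStep hab hda
    obtain ⟨T, hd', hT⟩ := ih (hs.reps hab hda)
    refine ⟨insert d T, Finset.mem_insert_self _ _, fun z hz => ?_⟩
    rcases Finset.mem_insert.mp hz with rfl | hz
    · exact Or.inr ⟨d', Finset.mem_insert_of_mem hd', _, hda.1, hs⟩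
    · exact (hT z hz).imp_right fun ⟨w, hw, h⟩ => ⟨w, Finset.mem_insert_of_mem hw, h⟩

theorem accepts_iff {M : Machine} {b : ℝ} {L R : HF ℝ} (hL : ¬ IsAtom L) (hR : ¬ IsAtom R)
    {z w : List ℝ} {b' : ℝ} (hLR : ∀ i, tape L R i = inputMap z i) (hzw : M.Computes z w)
    (hw : w = [b']) : Accepts M b L R ↔ b' = b := by
  obtain ⟨next, η, x, hnext, hrun, hout, hx⟩ := hzw
  -- The output has length one, so its only entry is the coordinate `1`, which `Halted` reads.
  have hb' : x 1 = b' := by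
    rw [hw, outputMap] at hx
    have hlen := congrArg List.length hx
    rw [List.length_ofFn, List.length_singleton] at hlen
    have := congrArg (fun l => l[0]?) hx
    simpa [List.getElem?_ofFn, hlen] using this
  constructor
  · rintro ⟨next', hnext', T, ⟨d, hd, h1, rfl, rfl⟩, hT⟩
    obtain rfl : next' = next := by
      rw [hnext] at hnext'
      injection hnext' with h
      exact h.symm
    rw [← hb']
    exact output_of_closed hT hrun hout hd ⟨h1, hLR⟩
  · rintro rfl
    obtain ⟨d, h1, rfl, rfl⟩ := exists_conf next hL hR
    obtain ⟨T, hd, hT⟩ := exists_closed hrun hout (d := d) ⟨h1, hLR⟩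
    obtain ⟨T', hT'⟩ := exists_mem_iff T
    refine ⟨next, hnext, T', ⟨d, (hT' d).mpr hd, h1, rfl, rfl⟩, fun z hz => ?_⟩
    rw [← hb']
    exact (hT z ((hT' z).mp hz)).imp_right fun ⟨w, hw, h⟩ => ⟨w, (hT' w).mpr hw, h⟩

/-! ### Lists of reals -/

/-- `d` codes the list `a`. -/
inductive Lst : HF ℝ → List ℝ → Prop
  | nil : Lst emp []
  | cons {d : HF ℝ} {a : List ℝ} (hd : d ≠ emp) (h : Lst (tail d) a) : Lst d (head d :: a)

theorem exists_lst (d : HF ℝ) : ∃ a, Lst d a := by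
  induction d using tail_induction with
  | h0 => exact ⟨_, .nil⟩
  | h1 d hd ih =>
    obtain ⟨a, ha⟩ := ih
    exact ⟨_, .cons hd ha⟩

theorem Lst.unique {d : HF ℝ} {a b : List ℝ} (ha : Lst d a) (hb : Lst d b) : a = b := by
  induction ha generalizing b with
  | nil =>
    cases hb with
    | nil => rfl
    | cons hd _ => exact (hd rfl).elim
  | cons hd _ ih =>
    cases hb with
    | nil => exact (hd rfl).elim
    | cons _ hb => rw [ih hb]

/-- The list that an element of `HF(ℝ)` codes. -/
noncomputable def lst (d : HF ℝ) : List ℝ := (exists_lst d).choose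

theorem lst_spec (d : HF ℝ) : Lst d (lst d) := (exists_lst d).choose_spec

theorem lst_emp : lst emp = [] := (lst_spec _).unique .nil

theorem lst_of_ne {d : HF ℝ} (hd : d ≠ emp) : lst d = head d :: lst (tail d) :=
  (lst_spec _).unique (.cons hd (lst_spec _))

theorem exists_lst_eq (a : List ℝ) : ∃ d, ¬ IsAtom d ∧ lst d = a := by
  induction a with
  | nil => exact ⟨emp, not_isAtom_emp, lst_emp⟩
  | cons x a ih =>
    obtain ⟨t, ht, rfl⟩ := ih
    obtain ⟨d, hd, hd0, rfl, rfl⟩ := exists_cons x ht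
    exact ⟨d, hd, lst_of_ne hd0⟩

/-- The finite sequence that an element of `HF(ℝ)` represents: the reverse of the list that its
tail codes. -/
noncomputable def seqOf (d : HF ℝ) : List ℝ := (lst (tail d)).reverse

/-- `seqOf` decodes a tail because a tail is never the singleton of an atom and can be a field of a
tuple. It reverses because pushing a list entry by entry onto the tape reverses it. -/
theorem seqOf_surjective : Function.Surjective seqOf := by
  intro a
  obtain ⟨t, ht, h⟩ := exists_lst_eq a.reverse
  obtain ⟨d, -, -, -, rfl⟩ := exists_cons 0 ht
  exact ⟨d, by rw [seqOf, h, List.reverse_reverse]⟩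

/-! ### Inputs on the tape -/

/-- The entries of `d` are those of `z`, followed by zeros. -/
def Holds (d : HF ℝ) (z : List ℝ) : Prop := ∀ j, head (tail^[j] d) = z.getD j 0

theorem holds_emp : Holds emp [] := fun j => by
  rw [Function.iterate_fixed tail_emp, head_emp, List.getD_nil]

theorem Holds.cons {d : HF ℝ} {z : List ℝ} (h : Holds (tail d) z) : Holds d (head d :: z) := by
  rintro (_ | j)
  · rfl
  · rw [Function.iterate_succ_apply, h j, List.getD_cons_succ]

/-- The tape `(L, R)` is the input `z`. -/
structure IsInput (L R : HF ℝ) (z : List ℝ) : Prop where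
  left : ¬ IsAtom L
  right : ¬ IsAtom R
  ones : Holds L (List.replicate z.length 1)
  entries : Holds R z

theorem isInput_emp : IsInput emp emp [] :=
  ⟨not_isAtom_emp, not_isAtom_emp, holds_emp, holds_emp⟩

/-- Each new entry on the right is matched by a new one on the left, so the row of ones always
records the length. -/
theorem IsInput.cons {L R L' R' : HF ℝ} {z : List ℝ} (h : IsInput L R z) (hL : ¬ IsAtom L')
    (hR : ¬ IsAtom R') (h1 : head L' = 1) (h2 : tail L' = L) (h3 : tail R' = R) :
    IsInput L' R' (head R' :: z) := by
  subst h2 h3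
  refine ⟨hL, hR, ?_, h.entries.cons⟩
  rw [List.length_cons, List.replicate_succ, ← h1]
  have := h.ones.cons
  rwa [h1] at this ⊢

theorem IsInput.tape_eq {L R : HF ℝ} {z : List ℝ} (h : IsInput L R z) (i : ℤ) :
    tape L R i = inputMap z i := by
  change _ = if 1 ≤ i then z.getD (i - 1).toNat 0 else if -(z.length : ℤ) < i then 1 else 0
  rw [tape, h.ones, h.entries]
  split_ifs with h1 h2
  · rfl
  · rw [List.getD_eq_getElem _ _ (by simp; omega), List.getElem_replicate]
  · rw [List.getD_eq_default _ _ (by simp; omega)]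

/-- One step of the transfer of a list, which is the field `1` of `d`, to the tape, the halves of
which are the fields `2` and `3`; the head of `d` counts the steps. -/
def PushStep (d d' : HF ℝ) : Prop :=
  head d' = head d + 1 ∧ field 1 d' = tail (field 1 d) ∧
    (head (field 2 d') = 1 ∧ tail (field 2 d') = field 2 d) ∧
    (head (field 3 d') = head (field 1 d) ∧ tail (field 3 d') = field 3 d)

/-- The end of the transfer, at which the number of steps is written to the tape. -/
def PushEnd (L R d : HF ℝ) : Prop :=
  (head L = 1 ∧ tail L = field 2 d) ∧ (head R = head d ∧ tail R = field 3 d)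

/-- The tape `(L', R')` is `(L, R)` with the length and the entries of the reverse of the list `t`
put in front of the entries. -/
def Push (t L R L' R' : HF ℝ) : Prop :=
  (¬ IsAtom L' ∧ ¬ IsAtom R') ∧ ∃ T : HF ℝ,
    (∃ d ∈ T, head d = 0 ∧ field 1 d = t ∧ field 2 d = L ∧ field 3 d = R) ∧
    ∀ d ∈ T, (field 1 d = emp ∧ PushEnd L' R' d) ∨ (field 1 d ≠ emp ∧ ∃ d' ∈ T, PushStep d d')

theorem SFun.emp (h0 : emp ∈ Set.range c) : SFun c (fun _ : Env n => emp) := by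
  obtain ⟨j, hj⟩ := h0
  rw [← hj]
  exact SFun.param j

theorem Sig.push (h0 : emp ∈ Set.range c) {t L R L' R' : Env n → HF ℝ} (ht : SFun c t)
    (hL : SFun c L) (hR : SFun c R) (hL' : SFun c L') (hR' : SFun c R') :
    Sig c (fun e => Push (t e) (L e) (R e) (L' e) (R' e)) := by
  refine ((Sig.not_isAtom hL').and (Sig.not_isAtom hR')).and (Sig.ex (Sig.and ?_ ?_))
  · exact Sig.bex SFun.hd ((Sig.req (RFun.head h0 SFun.hd) RFun.zero).and
      ((Sig.eq (SFun.field h0 1 SFun.hd) ht.wk.wk).and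
        ((Sig.eq (SFun.field h0 2 SFun.hd) hL.wk.wk).and
          (Sig.eq (SFun.field h0 3 SFun.hd) hR.wk.wk))))
  · refine Sig.ball SFun.hd (Sig.or ?_ ?_)
    · have hd1 : SFun c (fun e : Env (n + 1 + 1) => e.hd) := SFun.hd
      exact (Sig.eq (SFun.field h0 1 hd1) (SFun.emp h0)).and
        (((Sig.req (RFun.head h0 hL'.wk.wk) RFun.one).and
          (Sig.eq (SFun.tail h0 hL'.wk.wk) (SFun.field h0 2 hd1))).and
        ((Sig.req (RFun.head h0 hR'.wk.wk) (RFun.head h0 hd1)).and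
          (Sig.eq (SFun.tail h0 hR'.wk.wk) (SFun.field h0 3 hd1))))
    · have hd1 : SFun c (fun e : Env (n + 1 + 1 + 1) => e.tl.hd) := SFun.hd.wk
      have hd2 : SFun c (fun e : Env (n + 1 + 1 + 1) => e.hd) := SFun.hd
      refine (Sig.ne (SFun.field h0 1 SFun.hd) (SFun.emp h0)).and (Sig.bex SFun.hd.wk ?_)
      exact (Sig.req (RFun.head h0 hd2) ((RFun.head h0 hd1).add RFun.one)).and
        ((Sig.eq (SFun.field h0 1 hd2) (SFun.tail h0 (SFun.field h0 1 hd1))).and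
        (((Sig.req (RFun.head h0 (SFun.field h0 2 hd2)) RFun.one).and
          (Sig.eq (SFun.tail h0 (SFun.field h0 2 hd2)) (SFun.field h0 2 hd1))).and
        ((Sig.req (RFun.head h0 (SFun.field h0 3 hd2)) (RFun.head h0 (SFun.field h0 1 hd1))).and
          (Sig.eq (SFun.tail h0 (SFun.field h0 3 hd2)) (SFun.field h0 3 hd1)))))

/-- Induction on the part of the list still to be moved. The invariant is that the steps counted so
far plus the remaining length give the final count, which is written last and so stands in front of
the block. -/
theorem isInput_of_closed {L' R' T : HF ℝ} (hL' : ¬ IsAtom L') (hR' : ¬ IsAtom R')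
    (hT : ∀ d ∈ T, (field 1 d = emp ∧ PushEnd L' R' d) ∨
      (field 1 d ≠ emp ∧ ∃ d' ∈ T, PushStep d d')) (t : HF ℝ) :
    ∀ d ∈ T, field 1 d = t → ∀ z, IsInput (field 2 d) (field 3 d) z →
      IsInput L' R' ((head d + (lst t).length) :: ((lst t).reverse ++ z)) := by
  induction t using tail_induction with
  | h0 =>
    intro d hd ht z hz
    rcases hT d hd with ⟨-, ⟨h1, h2⟩, h3, h4⟩ | ⟨h, -⟩
    · have := hz.cons hL' hR' h1 h2 h4
      rw [h3] at this
      simpa [lst_emp] using this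
    · exact (h ht).elim
  | h1 t ht0 ih =>
    intro d hd ht z hz
    rcases hT d hd with ⟨h, -⟩ | ⟨-, d', hd', h1, h2, ⟨h3, h4⟩, h5, h6⟩
    · exact (ht0 (ht ▸ h)).elim
    · have := ih d' hd' (ht ▸ h2) _
        (hz.cons (not_isAtom_field 2 d') (not_isAtom_field 3 d') h3 h4 h6)
      rw [h1, h5, ht] at this
      rw [lst_of_ne ht0]
      convert this using 2
      · push_cast [List.length_cons]
        ring
      · simp

theorem Push.isInput {t L R L' R' : HF ℝ} (h : Push t L R L' R') {z : List ℝ}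
    (hz : IsInput L R z) : IsInput L' R' (RStructure.block (lst t).reverse ++ z) := by
  obtain ⟨⟨hL', hR'⟩, T, ⟨d, hd, h1, h2, rfl, rfl⟩, hT⟩ := h
  simpa [h1, RStructure.block] using isInput_of_closed hL' hR' hT t d hd h2 z hz

theorem exists_push_closed (t : HF ℝ) : ∀ (k : ℝ) (L R : HF ℝ), ¬ IsAtom t → ¬ IsAtom L →
    ¬ IsAtom R → ∃ (L' R' : HF ℝ) (T : Finset (HF ℝ)), ¬ IsAtom L' ∧ ¬ IsAtom R' ∧
      (∃ d ∈ T, head d = k ∧ field 1 d = t ∧ field 2 d = L ∧ field 3 d = R) ∧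
      ∀ d ∈ T, (field 1 d = emp ∧ PushEnd L' R' d) ∨
        (field 1 d ≠ emp ∧ ∃ d' ∈ T, PushStep d d') := by
  classical
  have htup : ∀ (k : ℝ) (t L R : HF ℝ), ¬ IsAtom t → ¬ IsAtom L → ¬ IsAtom R →
      ∃ d, head d = k ∧ field 1 d = t ∧ field 2 d = L ∧ field 3 d = R := by
    intro k t L R ht hL hR
    obtain ⟨d, h1, h2⟩ := exists_tuple k ![t, L, R] (by
      intro i
      fin_cases i
      exacts [ht, hL, hR])
    exact ⟨d, h1, h2 0, h2 1, h2 2⟩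
  induction t using tail_induction with
  | h0 =>
    intro k L R ht hL hR
    obtain ⟨d, h1, h2, h3, h4⟩ := htup k _ L R ht hL hR
    obtain ⟨L', hL', -, h5, h6⟩ := exists_cons 1 hL
    obtain ⟨R', hR', -, h7, h8⟩ := exists_cons k hR
    refine ⟨L', R', {d}, hL', hR', ⟨d, by simp, h1, h2, h3, h4⟩, fun z hz => Or.inl ?_⟩
    obtain rfl := Finset.mem_singleton.mp hz
    exact ⟨h2, ⟨h5, by rw [h6, h3]⟩, by rw [h7, h1], by rw [h8, h4]⟩
  | h1 t ht0 ih =>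
    intro k L R ht hL hR
    obtain ⟨d, h1, h2, h3, h4⟩ := htup k t L R ht hL hR
    obtain ⟨L1, hL1, -, h5, h6⟩ := exists_cons 1 hL
    obtain ⟨R1, hR1, -, h7, h8⟩ := exists_cons (head t) hR
    obtain ⟨L', R', T, hL', hR', ⟨d', hd', e1, e2, e3, e4⟩, hT⟩ :=
      ih (k + 1) L1 R1 (not_isAtom_tail t) hL1 hR1
    refine ⟨L', R', insert d T, hL', hR', ⟨d, Finset.mem_insert_self _ _, h1, h2, h3, h4⟩,
      fun z hz => ?_⟩
    rcases Finset.mem_insert.mp hz with rfl | hz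
    · refine Or.inr ⟨by rwa [h2], d', Finset.mem_insert_of_mem hd', by rw [e1, h1],
        by rw [e2, h2], ⟨by rw [e3, h5], by rw [e3, h6, h3]⟩, by rw [e4, h7, h2],
        by rw [e4, h8, h4]⟩
    · exact (hT z hz).imp_right fun ⟨h, w, hw, h'⟩ => ⟨h, w, Finset.mem_insert_of_mem hw, h'⟩

theorem exists_push {t L R : HF ℝ} (ht : ¬ IsAtom t) (hL : ¬ IsAtom L) (hR : ¬ IsAtom R) :
    ∃ L' R', Push t L R L' R' := by
  obtain ⟨L', R', T, hL', hR', ⟨d, hd, h⟩, hT⟩ := exists_push_closed t 0 L R ht hL hR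
  obtain ⟨T', hT'⟩ := exists_mem_iff T
  exact ⟨L', R', ⟨hL', hR'⟩, T', ⟨d, (hT' d).mpr hd, h⟩, fun z hz =>
    (hT z ((hT' z).mp hz)).imp_right fun ⟨h, w, hw, h'⟩ => ⟨h, w, (hT' w).mpr hw, h'⟩⟩

/-- The tape `(L, R)` is the input that consists of the blocks of the sequences that the elements
of `ds` represent. -/
def InputRel : List (HF ℝ) → HF ℝ → HF ℝ → Prop
  | [], L, R => L = emp ∧ R = emp
  | d :: ds, L, R => ∃ L' R', InputRel ds L' R' ∧ Push (tail d) L' R' L R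

theorem InputRel.isInput {ds : List (HF ℝ)} {L R : HF ℝ} (h : InputRel ds L R) :
    IsInput L R (ds.flatMap fun d => RStructure.block (seqOf d)) := by
  induction ds generalizing L R with
  | nil =>
    obtain ⟨rfl, rfl⟩ := h
    exact isInput_emp
  | cons d ds ih =>
    obtain ⟨L', R', h1, h2⟩ := h
    rw [List.flatMap_cons]
    exact h2.isInput (ih h1)

theorem exists_inputRel (ds : List (HF ℝ)) : ∃ L R, InputRel ds L R := by
  induction ds with
  | nil => exact ⟨_, _, rfl, rfl⟩
  | cons d ds ih =>
    obtain ⟨L, R, h⟩ := ih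
    obtain ⟨L', R', h'⟩ := exists_push (not_isAtom_tail d) h.isInput.left h.isInput.right
    exact ⟨L', R', L, R, h, h'⟩

/-- Each block adds two quantified variables for the intermediate tape; `σ` tracks the original
variables in the growing context. -/
theorem Sig.inputRel (h0 : emp ∈ Set.range c) (is : List (Fin n)) : ∀ {m : ℕ} (σ : Fin n → Fin m)
    {L R : Env m → HF ℝ}, SFun c L → SFun c R →
      Sig c (fun e => InputRel (is.map fun i => e (σ i)) (L e) (R e)) := by
  induction is with
  | nil =>
    intro m σ L R hL hR
    exact (Sig.eq hL (SFun.emp h0)).and (Sig.eq hR (SFun.emp h0))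
  | cons i is ih =>
    intro m σ L R hL hR
    refine Sig.ex (Sig.ex (Sig.and ?_ ?_))
    · exact ih (fun i => (σ i).castSucc.castSucc) SFun.hd.wk SFun.hd
    · exact Sig.push h0 (SFun.tail h0 (SFun.var (σ i)).wk.wk) SFun.hd.wk SFun.hd hL.wk.wk hR.wk.wk

/-- The machine `M` has the output entry `b` for the input that consists of `q` and of the blocks
of the sequences that the elements of `ds` represent. -/
def Decides (M : Machine) (b q : ℝ) (ds : List (HF ℝ)) : Prop :=
  ∃ L' R' L R, InputRel ds L' R' ∧ ((¬ IsAtom L ∧ ¬ IsAtom R) ∧ (head L = 1 ∧ tail L = L') ∧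
    (head R = q ∧ tail R = R')) ∧ Accepts M b L R

theorem Sig.decides (h0 : emp ∈ Set.range c) {M : Machine} (hM : HasCoeffs c M) (b q : ℕ)
    (is : List (Fin n)) : Sig c (fun e : Env n => Decides M b q (is.map e)) := by
  refine Sig.ex (Sig.ex (Sig.ex (Sig.ex (Sig.and ?_ (Sig.and ?_ ?_)))))
  · exact Sig.inputRel h0 is (fun i => i.castSucc.castSucc.castSucc.castSucc) SFun.hd.wk.wk.wk
      SFun.hd.wk.wk
  · exact ((Sig.not_isAtom SFun.hd.wk).and (Sig.not_isAtom SFun.hd)).and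
      (((Sig.req (RFun.head h0 SFun.hd.wk) RFun.one).and
        (Sig.eq (SFun.tail h0 SFun.hd.wk) SFun.hd.wk.wk.wk)).and
      ((Sig.req (RFun.head h0 SFun.hd) (RFun.natCast q)).and
        (Sig.eq (SFun.tail h0 SFun.hd) SFun.hd.wk.wk)))
  · exact Sig.accepts h0 hM b SFun.hd.wk SFun.hd

/-- All tapes admitted by `InputRel` represent the same input, so the choice of witnesses is
immaterial. -/
theorem decides_iff {M : Machine} {b b' q : ℝ} {ds : List (HF ℝ)}
    (h : M.Computes (q :: ds.flatMap fun d => RStructure.block (seqOf d)) [b']) :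
    Decides M b q ds ↔ b' = b := by
  have key : ∀ {L' R' L R : HF ℝ}, InputRel ds L' R' → ((¬ IsAtom L ∧ ¬ IsAtom R) ∧
      (head L = 1 ∧ tail L = L') ∧ (head R = q ∧ tail R = R')) → (Accepts M b L R ↔ b' = b) := by
    rintro L' R' L R hI ⟨⟨hL, hR⟩, ⟨h1, h2⟩, rfl, h4⟩
    exact accepts_iff hL hR (hI.isInput.cons hL hR h1 h2 h4).tape_eq h rfl
  constructor
  · rintro ⟨L', R', L, R, hI, hC, hA⟩
    exact (key hI hC).mp hA
  · intro hb
    obtain ⟨L', R', hI⟩ := exists_inputRel ds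
    obtain ⟨L, hL, -, h1, h2⟩ := exists_cons 1 hI.isInput.left
    obtain ⟨R, hR, -, h3, h4⟩ := exists_cons q hI.isInput.right
    have hC := (⟨⟨hL, hR⟩, ⟨h1, h2⟩, h3, h4⟩ : (¬ IsAtom L ∧ ¬ IsAtom R) ∧
      (head L = 1 ∧ tail L = L') ∧ (head R = q ∧ tail R = R'))
    exact ⟨L', R', L, R, hI, hC, (key hI hC).mpr hb⟩

open Classical in
theorem decides_one_iff {M : Machine} {S : Set (List ℝ)}
    (h : ∀ z, M.Computes z (if z ∈ S then [1] else [0])) {q : ℝ} {ds : List (HF ℝ)} :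
    Decides M 1 q ds ↔ (q :: ds.flatMap fun d => RStructure.block (seqOf d)) ∈ S := by
  have h' := h (q :: ds.flatMap fun d => RStructure.block (seqOf d))
  split_ifs at h' with hS
  · simp [decides_iff h', hS]
  · simp [decides_iff h', hS]

open Classical in
theorem decides_zero_iff {M : Machine} {S : Set (List ℝ)}
    (h : ∀ z, M.Computes z (if z ∈ S then [1] else [0])) {q : ℝ} {ds : List (HF ℝ)} :
    Decides M 0 q ds ↔ (q :: ds.flatMap fun d => RStructure.block (seqOf d)) ∉ S := by
  have h' := h (q :: ds.flatMap fun d => RStructure.block (seqOf d))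
  split_ifs at h' with hS
  · simp [decides_iff h', hS]
  · simp [decides_iff h', hS]

/-! ### Codes of atomic sentences -/

/-- The leading entry is the length, which tells where the block ends. -/
theorem block_append_inj {a b : List ℝ} {s t : List ℝ}
    (h : RStructure.block a ++ s = RStructure.block b ++ t) : a = b ∧ s = t := by
  rw [RStructure.block, RStructure.block, List.cons_append, List.cons_append,
    List.cons.injEq] at h
  exact List.append_inj h.2 (by exact_mod_cast h.1)

theorem flatMap_block_inj {s t : List (List ℝ)} (hl : s.length = t.length)
    (h : s.flatMap RStructure.block = t.flatMap RStructure.block) : s = t := by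
  induction s generalizing t with
  | nil => exact (List.length_eq_zero_iff.mp hl.symm).symm
  | cons a s ih =>
    rcases t with _ | ⟨b, t⟩
    · simp at hl
    · rw [List.flatMap_cons, List.flatMap_cons] at h
      obtain ⟨rfl, h'⟩ := block_append_inj h
      rw [ih (by simpa using hl) h']

section

variable {L : FirstOrder.Language.{u, v}} [Encodable (Σ n, L.Relations n)] {A : Set (List ℝ)}
  [L.Structure A]

open RStructure

/-- Equalities start with `0` and relations with a positive number, so the two kinds of codes never
coincide. -/
theorem eqCode_mem_iff {a b : List ℝ} : eqCode a b ∈ atomicDiagram L A ↔ a ∈ A ∧ a = b := by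
  constructor
  · rintro (⟨a', b', rfl, h⟩ | ⟨n, R, x, -, h⟩)
    · rw [eqCode, eqCode, List.cons.injEq] at h
      obtain ⟨rfl, h⟩ := block_append_inj h.2
      have h' := block_append_inj (s := []) (t := []) (by simpa using h)
      exact ⟨a'.2, h'.1.symm⟩
    · rw [eqCode, relCode, List.cons.injEq] at h
      have := h.1
      have h2 : (0 : ℝ) < (Encodable.encode (⟨n, R⟩ : Σ n, L.Relations n) : ℝ) + 1 := by positivity
      exact (h2.ne this).elim
  · rintro ⟨ha, rfl⟩
    exact Or.inl ⟨⟨a, ha⟩, ⟨a, ha⟩, rfl, rfl⟩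

theorem relCode_mem_iff {n : ℕ} {R : L.Relations n} {x : Fin n → A} :
    relCode R (fun i => (x i : List ℝ)) ∈ atomicDiagram L A ↔ Structure.RelMap R x := by
  constructor
  · rintro (⟨a', b', -, h⟩ | ⟨m, R', y, hy, h⟩)
    · rw [eqCode, relCode, List.cons.injEq] at h
      have := h.1
      have h2 : (0 : ℝ) < (Encodable.encode (⟨n, R⟩ : Σ n, L.Relations n) : ℝ) + 1 := by positivity
      exact (h2.ne this.symm).elim
    · rw [relCode, relCode, List.cons.injEq] at h
      have h1 : Encodable.encode (⟨n, R⟩ : Σ n, L.Relations n) =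
          Encodable.encode (⟨m, R'⟩ : Σ n, L.Relations n) := by exact_mod_cast add_right_cancel h.1
      obtain ⟨rfl, h2⟩ := Sigma.mk.inj_iff.mp (Encodable.encode_injective h1)
      obtain rfl := eq_of_heq h2
      have h3 := List.ofFn_injective (flatMap_block_inj (by simp) h.2)
      have h4 : x = y := funext fun i => Subtype.ext (congrFun h3 i)
      rwa [h4]
  · intro h
    exact Or.inr ⟨n, R, x, h, rfl⟩

end

/-! ### The definability theorem -/

/-- The Σ-formula of a Σ-definable predicate. -/
theorem Sig.exists_sigmaFormula {P : Env n → Prop} (h : Sig c P) :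
    ∃ φ : SigmaFormula orderedRingLang p n, φ.definedSet c = {s | P s} := by
  obtain ⟨φ, hφ, h1⟩ := h (Fin n ⊕ Fin p) 0 (fun j => Sum.inl (Sum.inr j))
    (fun i => Sum.inl (Sum.inl i))
  refine ⟨⟨φ, hφ⟩, Set.ext fun s => ?_⟩
  exact h1 (Sum.elim s c) default (fun j => rfl)

/-- Finitely many nodes carry finitely many polynomials with finitely many coefficients. One tuple
serves all formulas, even for infinitely many relation symbols, since a symbol enters only through
its number. -/
theorem exists_params (M : Machine) : ∃ (p : ℕ) (c : Fin p → HF ℝ), emp ∈ Set.range c ∧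
    HasCoeffs c M := by
  classical
  let S : Finset (HF ℝ) := insert emp (Finset.univ.biUnion fun η =>
    (nodePolys (M.node η)).biUnion fun h => h.support.image fun m => atomSingleton (h.coeff m))
  have hS : ∀ a ∈ S, a ∈ Set.range (fun j => (S.equivFin.symm j : HF ℝ)) := fun a ha =>
    ⟨S.equivFin ⟨a, ha⟩, by simp⟩
  refine ⟨S.card, fun j => S.equivFin.symm j, hS _ (Finset.mem_insert_self _ _),
    fun η h hh m hm => hS _ (Finset.mem_insert_of_mem ?_)⟩
  simp only [Finset.mem_biUnion, Finset.mem_image]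
  exact ⟨η, Finset.mem_univ _, h, hh, m, hm, rfl⟩

end SigmaReal

open SigmaReal in
theorem mainTheorem3 {L : FirstOrder.Language.{u, v}} [L.IsRelational]
    [Encodable (Σ n, L.Relations n)] (A : Set (List ℝ)) (hA : A.Nonempty) [L.Structure A]
    (h : RStructure.IsRComputable L A) :
    IsSigmaDefinable L A orderedRingLang ℝ := by
  obtain ⟨M, hM⟩ := h
  obtain ⟨p, c, h0, hc⟩ := exists_params M
  let D : Set (HF ℝ) := {d | seqOf d ∈ A}
  -- Membership in `A` is decided by asking for the sentence `a = a`; the entry `0` marks an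
  -- equality.
  have hD : ∀ d, d ∈ D ↔ Decides M 1 0 [d, d] := fun d => by
    rw [decides_one_iff hM]
    have := eqCode_mem_iff (L := L) (A := A) (a := seqOf d) (b := seqOf d)
    simpa [RStructure.eqCode, D] using this.symm
  have hE : ∀ d d', (RStructure.eqCode (seqOf d) (seqOf d') ∈ RStructure.atomicDiagram L A) ↔
      Decides M 1 0 [d, d'] := fun d d' => by
    rw [decides_one_iff hM]
    simp [RStructure.eqCode]
  have hE' : ∀ d d', (RStructure.eqCode (seqOf d) (seqOf d') ∉ RStructure.atomicDiagram L A) ↔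
      Decides M 0 0 [d, d'] := fun d d' => by
    rw [decides_zero_iff hM]
    simp [RStructure.eqCode]
  have hR : ∀ (n : ℕ) (R : L.Relations n) (s : Fin n → HF ℝ),
      RStructure.relCode R (fun i => seqOf (s i)) =
        (((Encodable.encode (⟨n, R⟩ : Σ n, L.Relations n) + 1 : ℕ) : ℝ) ::
          ((List.finRange n).map s).flatMap fun d => RStructure.block (seqOf d)) := by
    intro n R s
    rw [RStructure.relCode, List.flatMap_map]
    push_cast
    congr 1
    rw [List.ofFn_eq_map, List.flatMap_map]
  have sD : ∀ {n : ℕ} (i : Fin n), Sig c (fun e : Env n => e i ∈ D) := fun i =>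
    (Sig.decides h0 hc 1 0 [i, i]).congr fun e => by
      rw [hD]
      simp
  have sDn : ∀ {n : ℕ}, Sig c (fun e : Env n => ∀ i, e i ∈ D) := Sig.forall_fin sD
  have sE : Sig c (fun e : Env 2 => (∀ i, e i ∈ D) ∧
      RStructure.eqCode (seqOf (e 0)) (seqOf (e 1)) ∈ RStructure.atomicDiagram L A) :=
    sDn.and ((Sig.decides h0 hc 1 0 [0, 1]).congr fun e => by
      rw [hE]
      simp)
  have sE' : Sig c (fun e : Env 2 => (∀ i, e i ∈ D) ∧
      RStructure.eqCode (seqOf (e 0)) (seqOf (e 1)) ∉ RStructure.atomicDiagram L A) :=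
    sDn.and ((Sig.decides h0 hc 0 0 [0, 1]).congr fun e => by
      rw [hE']
      simp)
  have sR : ∀ (n : ℕ) (R : L.Relations n), Sig c (fun e : Env n => (∀ i, e i ∈ D) ∧
      RStructure.relCode R (fun i => seqOf (e i)) ∈ RStructure.atomicDiagram L A) := fun n R =>
    sDn.and ((Sig.decides h0 hc 1 (Encodable.encode (⟨n, R⟩ : Σ n, L.Relations n) + 1)
      (List.finRange n)).congr fun e => by
      rw [hR, ← decides_one_iff hM]
      simp only [Nat.cast_one])
  have sR' : ∀ (n : ℕ) (R : L.Relations n), Sig c (fun e : Env n => (∀ i, e i ∈ D) ∧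
      RStructure.relCode R (fun i => seqOf (e i)) ∉ RStructure.atomicDiagram L A) := fun n R =>
    sDn.and ((Sig.decides h0 hc 0 (Encodable.encode (⟨n, R⟩ : Σ n, L.Relations n) + 1)
      (List.finRange n)).congr fun e => by
      rw [hR, ← decides_zero_iff hM]
      simp only [Nat.cast_zero])
  obtain ⟨Ψ₀, hΨ₀⟩ := (sD (0 : Fin 1)).exists_sigmaFormula
  obtain ⟨Ψ₁, hΨ₁⟩ := sE.exists_sigmaFormula
  obtain ⟨Ψ₁', hΨ₁'⟩ := sE'.exists_sigmaFormula
  choose Φ hΦ using fun n R => (sR n R).exists_sigmaFormula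
  choose Φ' hΦ' using fun n R => (sR' n R).exists_sigmaFormula
  -- Decoding. Relations on `D` are pulled back along `q`, so its kernel is a congruence and the
  -- quotient is `A`.
  let q : D → A := fun d => ⟨seqOf d, d.2⟩
  have hq : Function.Surjective q := by
    rintro ⟨a, ha⟩
    obtain ⟨d, rfl⟩ := seqOf_surjective a
    exact ⟨⟨d, ha⟩, rfl⟩
  let s : Setoid D := Setoid.ker q
  let P : L.Prestructure s :=
    { toStructure :=
        { funMap := fun f => isEmptyElim f
          RelMap := fun R x => Structure.RelMap R (q ∘ x) }
      fun_equiv := fun {_} f => isEmptyElim f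
      rel_equiv := fun {_} {R} x y hxy => by
        have : q ∘ x = q ∘ y := funext fun i => hxy i
        change Structure.RelMap R (q ∘ x) = Structure.RelMap R (q ∘ y)
        rw [this] }
  refine ⟨p, c, Ψ₀, Ψ₁, Ψ₁', Φ, Φ', D, fun a => ?_, ?_, ?_, ?_, fun n R => ?_, fun n R => ?_,
    s, P, fun a b => ?_, fun n R x => ?_, ?_⟩
  · simp [hΨ₀]
  · obtain ⟨a, ha⟩ := hA
    obtain ⟨d, rfl⟩ := seqOf_surjective a
    exact ⟨d, ha⟩
  · rw [hΨ₁]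
    exact fun e he => he.1
  · rw [hΨ₁, hΨ₁']
    ext e
    simp only [Set.mem_ofPred_eq, Set.mem_sdiff]
    tauto
  · rw [hΦ]
    exact fun e he => he.1
  · rw [hΦ, hΦ']
    ext e
    simp only [Set.mem_ofPred_eq, Set.mem_sdiff]
    tauto
  · rw [hΨ₁]
    have ha := a.2
    have hb := b.2
    simp only [Set.mem_ofPred_eq, eqCode_mem_iff, Fin.forall_fin_two]
    change q a = q b ↔ _
    rw [Subtype.ext_iff]
    exact ⟨fun h => ⟨⟨ha, hb⟩, ha, h⟩, fun h => h.2.2⟩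
  · rw [hΦ]
    have := relCode_mem_iff (R := R) (x := q ∘ x)
    exact this.symm.trans ⟨fun h => ⟨fun i => (x i).2, h⟩, fun h => h.2⟩
  · let E : Quotient s ≃ A := Setoid.quotientKerEquivOfSurjective q hq
    refine ⟨Language.Equiv.symm ⟨E, fun {_} f => isEmptyElim f, fun {n} R x => ?_⟩⟩
    obtain ⟨y, rfl⟩ : ∃ y : Fin n → D, x = fun i => Quotient.mk s (y i) :=
      ⟨fun i => (x i).out, funext fun i => (Quotient.out_eq _).symm⟩
    rw [relMap_quotient_mk']
    rfl
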